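/- Let $H$ be a real Hilbert space and $\Phi:H\to\mathbb{R}\cup\{\pm\infty\}$ proper, convex and lower semicontinuous with $\operatorname{argmin}\Phi\neq\emptyset$; let $x^*$ be the element of minimal norm of $\operatorname{argmin}\Phi$. For $\lambda>0$ let $\Phi_\lambda(x)=\inf_{y\in H}\{\Phi(y)+\frac{1}{2\lambda}\|x-y\|^2\}$ be the Moreau envelope, and for $\varepsilon,\lambda>0$ let $\varphi_{\varepsilon,\lambda}(x)=\Phi_\lambda(x)+\frac{\varepsilon}{2}\|x\|^2$, with unique minimizer $x_{\varepsilon,\lambda}$. Let $\alpha,\beta,t_0>0$, let $\lambda:[t_0,\infty)\to(0,\infty)$ be continuously differentiable and nondecreasing, and let $\varepsilon:[t_0,\infty)\to(0,\infty)$ be continuously differentiable and nonincreasing with $\varepsilon(t)\to0$ as $t\to\infty$. Let $x:[t_0,\infty)\to H$ be a strong solution of $$\ddot x(t)+\alpha\sqrt{\varepsilon(t)}\,\dot x(t)+\beta\frac{d}{dt}\big(\nabla\Phi_{\lambda(t)}(x(t))\big)+\nabla\Phi_{\lambda(t)}(x(t))+\varepsilon(t)x(t)=0,$$ that is, $x$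 is differentiable, $\dot x$ is locally absolutely continuous, and the equation holds for almost every $t\ge t_0$. Assume that $\lambda(t)\varepsilon(t)\to0$ as $t\to\infty$, that $\frac{\alpha}{2}\le\gamma<\alpha$, and that $a,c>0$ are such that for all sufficiently large $t$ $$\frac{d}{dt}\Big(\frac1{\sqrt{\varepsilon(t)}}\Big)\le\min\Big\{2\gamma-\alpha-\frac{\gamma\beta\dot\varepsilon(t)}{2\varepsilon(t)},\ \alpha-\gamma\frac{a+1}{a}\Big\},$$ $$\Big(2\gamma(\alpha-\gamma)+\frac{\gamma}{c}-1\Big)\varepsilon(t)-\beta\dot\varepsilon(t)\le0,$$ $$2\beta\varepsilon^2(t)+\big(2-\gamma\beta\sqrt{\varepsilon(t)}\big)\dot\varepsilon(t)\le0,$$ $$\Big(\frac{\gamma}{a}+2(\alpha-\gamma)\Big)\beta^2\sqrt{\varepsilon(t)}-\frac{3\beta^2\dot\varepsilon(t)}{2\varepsilon(t)}-\dot\lambda(t)\le\beta.$$ Put $$E(t)=\varphi_{\varepsilon(t),\lambda(t)}(x(t))-\varphi_{\varepsilon(t),\lambda(t)}(x_{\varepsilon(t),\lambda(t)})+\frac12\big\|\gamma\sqrt{\varepsilon(t)}\,(x(t)-x_{\varepsilon(t),\lambda(t)})+\dot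 x(t)+\beta\nabla\Phi_{\lambda(t)}(x(t))\big\|^2,$$ $$\mu(t)=(\alpha-\gamma)\sqrt{\varepsilon(t)}-\frac{\dot\varepsilon(t)}{2\varepsilon(t)},$$ $$g(t)=\dot\lambda(t)\varepsilon^2(t)-\dot\varepsilon(t)+\frac{\gamma\beta\dot\varepsilon(t)\sqrt{\varepsilon(t)}}{2}+\gamma(2a+c\gamma)\sqrt{\varepsilon(t)}\Big(\frac{2\dot\lambda(t)}{\lambda(t)}-\frac{\dot\varepsilon(t)}{\varepsilon(t)}\Big)^2 .$$ Then there exists $t_1\ge t_0$ such that, with $\Gamma(t)=\exp\big(\int_{t_1}^t\mu(s)\,ds\big)$, the following hold. 1. $E$ is locally absolutely continuous on $[t_1,\infty)$, and for almost every $t\ge t_1$ it is differentiable at $t$ with $$\dot E(t)+\mu(t)E(t)+\frac{\beta}{2}\|\nabla\varphi_{\varepsilon(t),\lambda(t)}(x(t))\|^2\le\frac{g(t)\|x^*\|^2}{2}.$$ 2. For all $t\ge t_1$, $$\beta\int_{t_1}^t\|\nabla\varphi_{\varepsilon(s),\lambda(s)}(x(s))\|^2\,ds\le2E(t_1)+\|x^*\|^2\int_{t_1}^tg(s)\,ds$$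 (the integral on the left being of an integrable function). 3. For all $t\ge t_1$, $$E(t)\le\frac{\|x^*\|^2}{2\Gamma(t)}\int_{t_1}^t\Gamma(s)g(s)\,ds+\frac{\Gamma(t_1)E(t_1)}{\Gamma(t)}.$$ -/

import Mathlib

open Set Filter Topology MeasureTheory

noncomputable section

namespace TikhonovMoreau

variable {H : Type*} [NormedAddCommGroup H] [InnerProductSpace ℝ H] [CompleteSpace H]

/-- A proper, convex and lower semicontinuous extended-real-valued function. -/
structure IsProperConvexLsc (Φ : H → EReal) : Prop where
  ne_bot : ∀ x, Φ x ≠ ⊥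
  exists_ne_top : ∃ x, Φ x ≠ ⊤
  convex : ∀ x y : H, ∀ a b : ℝ, 0 < a → 0 < b → a + b = 1 →
    Φ (a • x + b • y) ≤ (a : EReal) * Φ x + (b : EReal) * Φ y
  lsc : LowerSemicontinuous Φ

/-- The set of global minimizers of `Φ`. -/
def argminSet (Φ : H → EReal) : Set H := {z | ∀ y, Φ z ≤ Φ y}

/-- A minimizer of the real-valued function `f` over the set `S` (an arbitrary point of `H` if
there is none). -/
def argminOn (f : H → ℝ) (S : Set H) : H :=
  Classical.epsilon fun z => z ∈ S ∧ IsMinOn f S z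

/-- The projection of `0` onto the set of minimizers of `Φ`, i.e. the minimizer of least norm. -/
def minNormSol (Φ : H → EReal) : H := argminOn (fun z => ‖z‖) (argminSet Φ)

/-- The Moreau envelope `Φ_l (x) = inf_y { Φ y + ‖x - y‖² / (2 l) }` of index `l`. -/
def moreau (Φ : H → EReal) (l : ℝ) (x : H) : ℝ :=
  (⨅ y : H, Φ y + ((1 / (2 * l) * ‖x - y‖ ^ 2 : ℝ) : EReal)).toReal

/-- The regularized function `φ_{e,l} (x) = Φ_l (x) + e ‖x‖² / 2`. -/
def phi (Φ : H → EReal) (e l : ℝ) (x : H) : ℝ := moreau Φ l x + e * ‖x‖ ^ 2 / 2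

/-- The minimizer `x_{e,l}` of `φ_{e,l}` over the whole space. -/
def regMin (Φ : H → EReal) (e l : ℝ) : H := argminOn (phi Φ e l) univ

/-- Derivative of a function on the half-line `[t₀, ∞)` (one-sided at `t₀`). -/
def dt {F : Type*} [NormedAddCommGroup F] [NormedSpace ℝ F] (t₀ : ℝ) (f : ℝ → F) (t : ℝ) : F :=
  derivWithin f (Ici t₀) t

/-- Strong solutions on `[t₀, ∞)` of
`x'' + α √ε x' + β (d/dt) ∇Φ_{lam(t)}(x(t)) + ∇Φ_{lam(t)}(x) + ε x = 0`:
`x` is differentiable, `x'` is locally absolutely continuous, and the equation, including the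
existence of both derivatives occurring in it, holds at almost every time. -/
structure IsSolution (Φ : H → EReal) (α β t₀ : ℝ) (lam eps : ℝ → ℝ) (x : ℝ → H) : Prop where
  differentiable : DifferentiableOn ℝ x (Ici t₀)
  velocity_ac : ∀ T, t₀ ≤ T → AbsolutelyContinuousOnInterval (dt t₀ x) t₀ T
  equation : ∀ᵐ t, t₀ < t → ∃ x'' w : H,
    HasDerivAt (dt t₀ x) x'' t ∧
    HasDerivAt (fun s => gradient (moreau Φ (lam s)) (x s)) w t ∧
    x'' + (α * √(eps t)) • dt t₀ x t + β • w
      + gradient (moreau Φ (lam t)) (x t) + eps t • x t = 0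

/-- The energy function along `x`. -/
def energy (Φ : H → EReal) (β γ t₀ : ℝ) (lam eps : ℝ → ℝ) (x : ℝ → H) (t : ℝ) : ℝ :=
  phi Φ (eps t) (lam t) (x t) - phi Φ (eps t) (lam t) (regMin Φ (eps t) (lam t))
    + 1 / 2 * ‖(γ * √(eps t)) • (x t - regMin Φ (eps t) (lam t)) + dt t₀ x t
        + β • gradient (moreau Φ (lam t)) (x t)‖ ^ 2

/-- The rate `μ(t) = (α - γ) √ε - ε' / (2 ε)`. -/
def mu (α γ t₀ : ℝ) (eps : ℝ → ℝ) (t : ℝ) : ℝ :=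
  (α - γ) * √(eps t) - dt t₀ eps t / (2 * eps t)

/-- The weight `Γ(t) = exp (∫_{t₁}^t μ)`. -/
def Gam (α γ t₀ : ℝ) (eps : ℝ → ℝ) (t₁ t : ℝ) : ℝ :=
  Real.exp (∫ s in t₁..t, mu α γ t₀ eps s)

/-- The function `g` on the right-hand side of the energy estimates. -/
def gfun (β γ a c t₀ : ℝ) (lam eps : ℝ → ℝ) (t : ℝ) : ℝ :=
  dt t₀ lam t * eps t ^ 2 - dt t₀ eps t + γ * β * dt t₀ eps t * √(eps t) / 2
    + γ * (2 * a + c * γ) * √(eps t)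
      * (2 * dt t₀ lam t / lam t - dt t₀ eps t / eps t) ^ 2

end TikhonovMoreau

end

/-! The energy E is a Lyapunov function. Write y for the regularized minimizer x_{ε,λ}.
Differentiating E along the equation produces quadratic terms in the gradient, the velocity and x -
y. Strong convexity of φ, Young's inequality and the parameter conditions absorb all of them except
a multiple of ‖y‖², and ‖y‖ ≤ ‖x*‖.

The envelope is handled through its resolvent: q = `yosida Φ l x` is characterized by q ∈ ∂Φ(x - l
q). Comparing two such points, by the subgradient inequality (`IsSubgrad.moreau_ge`) or by
monotonicity (`IsSubgrad.mul_norm_sub_sq_le`), gives joint differentiability of the envelope in (l,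
x), with partial derivative -‖q‖²/2 in l, and local Lipschitz dependence of q on (l, x). The same
estimates serve y, because y is -1/ε times the Yosida point of index 1/ε + λ at the origin, and the
minimum value of φ is the envelope of that index at the origin (`regMin_eq`, `phi_regMin`). Hence
the minimum value is C¹ in time, while y is only known to be locally Lipschitz.

The time derivative of y is never used. E is real-valued and absolutely continuous, hence
differentiable almost everywhere; at such a time the squared-norm part of E is differentiable too,
and right difference quotients bound its derivative with a surrogate vector d in place of y'
(`exists_hasDerivAt_half_norm_sq_le`), where ‖d‖ ≤ (2λ'/λ - ε'/ε)‖y‖ by `exists_regMin_bound`. What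
remains, `energy_inequality`, is Hilbert space algebra valid for every such d. The two integrated
estimates follow by discarding μE ≥ 0, respectively by multiplying by Γ. -/

noncomputable section

namespace TikhonovMoreau

open scoped InnerProductSpace

/-! ### Proximal points and subgradient comparison -/

section Prox

variable {H : Type*} [NormedAddCommGroup H] [InnerProductSpace ℝ H]

/-- `q` is a subgradient of `Φ` at the point `p` of its domain. -/
def IsSubgrad (Φ : H → EReal) (p q : H) : Prop :=
  Φ p ≠ ⊤ ∧ ∀ z, Φ z ≠ ⊤ → (Φ p).toReal + ⟪q, z - p⟫_ℝ ≤ (Φ z).toReal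

lemma IsProperConvexLsc.coe_toReal {Φ : H → EReal} (hΦ : IsProperConvexLsc Φ) {x : H}
    (hx : Φ x ≠ ⊤) : ((Φ x).toReal : EReal) = Φ x :=
  EReal.coe_toReal hx (hΦ.ne_bot x)

lemma IsProperConvexLsc.le_coe_iff {Φ : H → EReal} (hΦ : IsProperConvexLsc Φ) {x : H} {r : ℝ} :
    Φ x ≤ r ↔ Φ x ≠ ⊤ ∧ (Φ x).toReal ≤ r := by
  constructor
  · intro h
    have hx : Φ x ≠ ⊤ := fun h' => by simp [h'] at h
    refine ⟨hx, ?_⟩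
    rw [← hΦ.coe_toReal hx] at h
    exact_mod_cast h
  · rintro ⟨hx, h⟩
    rw [← hΦ.coe_toReal hx]
    exact_mod_cast h

lemma IsProperConvexLsc.toReal_convex {Φ : H → EReal} (hΦ : IsProperConvexLsc Φ) {x y : H}
    (hx : Φ x ≠ ⊤) (hy : Φ y ≠ ⊤) {a b : ℝ} (ha : 0 < a) (hb : 0 < b) (hab : a + b = 1) :
    Φ (a • x + b • y) ≠ ⊤ ∧
      (Φ (a • x + b • y)).toReal ≤ a * (Φ x).toReal + b * (Φ y).toReal := by
  rw [← hΦ.le_coe_iff]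
  have := hΦ.convex x y a b ha hb hab
  rw [← hΦ.coe_toReal hx, ← hΦ.coe_toReal hy] at this
  exact_mod_cast this

lemma IsProperConvexLsc.le_of_tendsto {Φ : H → EReal} (hΦ : IsProperConvexLsc Φ)
    {u : ℕ → H} {p : H} {r : ℕ → ℝ} {s : ℝ} (hu : Tendsto u atTop (𝓝 p))
    (hr : Tendsto r atTop (𝓝 s)) (h : ∀ n, Φ (u n) ≤ r n) : Φ p ≤ s := by
  by_contra! hlt
  obtain ⟨c, hsc, hcp⟩ := EReal.lt_iff_exists_real_btwn.1 hlt
  have h1 := hu.eventually (hΦ.lsc p c hcp)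
  have h2 := hr.eventually (gt_mem_nhds (EReal.coe_lt_coe_iff.1 hsc))
  obtain ⟨n, hn1, hn2⟩ := (h1.and h2).exists
  have h3 := hn1.trans_le (h n)
  exact absurd (EReal.coe_lt_coe_iff.1 h3) (not_lt.2 hn2.le)

/-- Every proper convex lower semicontinuous function with a minimizer has a proximal point. -/
lemma IsProperConvexLsc.exists_prox [CompleteSpace H] {Φ : H → EReal} (hΦ : IsProperConvexLsc Φ)
    (hne : (argminSet Φ).Nonempty) {l : ℝ} (hl : 0 < l) (x : H) :
    ∃ p, Φ p ≠ ⊤ ∧ ∀ z, Φ z ≠ ⊤ → (Φ p).toReal + 1 / (2 * l) * ‖x - p‖ ^ 2 ≤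
      (Φ z).toReal + 1 / (2 * l) * ‖x - z‖ ^ 2 := by
  obtain ⟨z₀, hz₀⟩ := hne
  obtain ⟨w, hw⟩ := hΦ.exists_ne_top
  have hz₀' : Φ z₀ ≠ ⊤ := fun h => hw (top_le_iff.1 (h ▸ hz₀ w))
  set J : H → ℝ := fun z => (Φ z).toReal + 1 / (2 * l) * ‖x - z‖ ^ 2 with hJ
  set S : Set ℝ := J '' {z | Φ z ≠ ⊤} with hS
  have hSne : S.Nonempty := ⟨_, mem_image_of_mem J hw⟩
  have hSbdd : BddBelow S := by
    refine ⟨(Φ z₀).toReal, ?_⟩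
    rintro _ ⟨z, hz, rfl⟩
    have : (Φ z₀).toReal ≤ (Φ z).toReal := EReal.toReal_le_toReal (hz₀ z) (hΦ.ne_bot _) hz
    have : 0 ≤ 1 / (2 * l) * ‖x - z‖ ^ 2 := by positivity
    simp only [hJ]; linarith
  have hlow : ∀ z, Φ z ≠ ⊤ → sInf S ≤ J z := fun z hz => csInf_le hSbdd (mem_image_of_mem J hz)
  have hex : ∀ n : ℕ, ∃ z, Φ z ≠ ⊤ ∧ J z < sInf S + 1 / ((n : ℝ) + 1) := by
    intro n
    obtain ⟨_, ⟨z, hz, rfl⟩, h⟩ := Real.lt_sInf_add_pos hSne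
      (show (0 : ℝ) < 1 / ((n : ℝ) + 1) by positivity)
    exact ⟨z, hz, h⟩
  choose u hu hJu using hex
  -- Convexity at the midpoint and the parallelogram identity: the quadratic term of `J` makes
  -- near-minimizers close to each other.
  have hmid : ∀ y z, Φ y ≠ ⊤ → Φ z ≠ ⊤ →
      ‖y - z‖ ^ 2 ≤ 8 * l * ((J y + J z) / 2 - sInf S) := by
    intro y z hy hz
    obtain ⟨h1, h2⟩ := hΦ.toReal_convex hy hz (a := 1 / 2) (b := 1 / 2) (by norm_num)
      (by norm_num) (by norm_num)
    have h3 := hlow _ h1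
    have h4 : ‖x - ((1 / 2 : ℝ) • y + (1 / 2 : ℝ) • z)‖ ^ 2 =
        (‖x - y‖ ^ 2 + ‖x - z‖ ^ 2) / 2 - ‖y - z‖ ^ 2 / 4 := by
      simp only [← real_inner_self_eq_norm_sq, inner_sub_left, inner_sub_right, inner_add_left,
        inner_add_right, real_inner_smul_left, real_inner_smul_right, real_inner_comm x y,
        real_inner_comm x z, real_inner_comm y z]
      ring
    simp only [hJ] at h3 ⊢
    rw [h4] at h3
    have h5 : ‖y - z‖ ^ 2 = 8 * l * (1 / (2 * l) * (‖y - z‖ ^ 2 / 4)) := by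
      field_simp; ring
    rw [h5]
    gcongr
    linarith
  have hcauchy : CauchySeq u := by
    refine cauchySeq_of_le_tendsto_0 (fun n : ℕ => √(8 * l * (1 / ((n : ℝ) + 1)))) ?_ ?_
    · intro n m N hn hm
      rw [dist_eq_norm]
      refine Real.le_sqrt_of_sq_le ((hmid _ _ (hu n) (hu m)).trans ?_)
      have e : ∀ k : ℕ, N ≤ k → 1 / ((k : ℝ) + 1) ≤ 1 / ((N : ℝ) + 1) :=
        fun k hk => one_div_le_one_div_of_le (by positivity) (by gcongr)
      gcongr
      linarith [hJu n, hJu m, e n hn, e m hm]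
    · have := (tendsto_one_div_add_atTop_nhds_zero_nat (𝕜 := ℝ)).const_mul (8 * l)
      simpa using this.sqrt
  obtain ⟨p, hp⟩ := cauchySeq_tendsto_of_complete hcauchy
  -- The bound on `J (u n)` is solved for `Φ (u n)`, so that lower semicontinuity of Φ alone carries
  -- it to the limit.
  have hle : Φ p ≤ ((sInf S + 0 - 1 / (2 * l) * ‖x - p‖ ^ 2 : ℝ) : EReal) := by
    refine hΦ.le_of_tendsto hp (r := fun n : ℕ => sInf S + 1 / ((n : ℝ) + 1)
      - 1 / (2 * l) * ‖x - u n‖ ^ 2) ?_ ?_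
    · exact (tendsto_const_nhds.add tendsto_one_div_add_atTop_nhds_zero_nat).sub
        (((tendsto_const_nhds.sub hp).norm.pow 2).const_mul _)
    · intro n
      refine hΦ.le_coe_iff.2 ⟨hu n, ?_⟩
      have := hJu n
      simp only [hJ] at this
      linarith
  obtain ⟨hp1, hp2⟩ := hΦ.le_coe_iff.1 hle
  refine ⟨p, hp1, fun z hz => ?_⟩
  have := hlow z hz
  simp only [hJ] at this
  linarith

lemma IsProperConvexLsc.exists_isSubgrad [CompleteSpace H] {Φ : H → EReal}
    (hΦ : IsProperConvexLsc Φ) (hne : (argminSet Φ).Nonempty) {l : ℝ} (hl : 0 < l) (x : H) :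
    ∃ q, IsSubgrad Φ (x - l • q) q := by
  obtain ⟨p, hp, hmin⟩ := hΦ.exists_prox hne hl x
  refine ⟨(1 / l) • (x - p), ?_⟩
  have hxp : x - l • (1 / l) • (x - p) = p := by
    rw [smul_smul, mul_one_div_cancel hl.ne', one_smul, sub_sub_cancel]
  rw [hxp]
  refine ⟨hp, fun z hz => ?_⟩
  rw [real_inner_smul_left]
  -- Minimality is tested at p + τ(z - p); after division by τ the quadratic error is of order τ and
  -- vanishes as τ → 0.
  have key : ∀ τ ∈ Ioo (0 : ℝ) 1, 1 / l * ⟪x - p, z - p⟫_ℝ - τ / (2 * l) * ‖z - p‖ ^ 2 ≤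
      (Φ z).toReal - (Φ p).toReal := by
    rintro τ ⟨h0, h1⟩
    obtain ⟨hc1, hc2⟩ := hΦ.toReal_convex hp hz (a := 1 - τ) (b := τ) (by linarith) h0 (by ring)
    have h3 := hmin _ hc1
    have h4 : x - ((1 - τ) • p + τ • z) = (x - p) - τ • (z - p) := by module
    rw [h4, norm_sub_sq_real (x - p), real_inner_smul_right, norm_smul, Real.norm_of_nonneg h0.le]
      at h3
    have h5 : τ * (1 / l * ⟪x - p, z - p⟫_ℝ - τ / (2 * l) * ‖z - p‖ ^ 2) ≤
        τ * ((Φ z).toReal - (Φ p).toReal) := by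
      have : τ * (1 / l * ⟪x - p, z - p⟫_ℝ - τ / (2 * l) * ‖z - p‖ ^ 2) =
        1 / (2 * l) * ‖x - p‖ ^ 2 - 1 / (2 * l) * (‖x - p‖ ^ 2 - 2 * (τ * ⟪x - p, z - p⟫_ℝ)
          + (τ * ‖z - p‖) ^ 2) := by field_simp; ring
      rw [this]
      linarith
    exact le_of_mul_le_mul_left h5 h0
  have hlim : Tendsto (fun τ : ℝ => 1 / l * ⟪x - p, z - p⟫_ℝ - τ / (2 * l) * ‖z - p‖ ^ 2)
      (𝓝[>] 0) (𝓝 (1 / l * ⟪x - p, z - p⟫_ℝ - 0 / (2 * l) * ‖z - p‖ ^ 2)) := by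
    refine Tendsto.mono_left (Continuous.tendsto (by fun_prop) 0) nhdsWithin_le_nhds
  have := _root_.le_of_tendsto hlim (by
    filter_upwards [Ioo_mem_nhdsGT (zero_lt_one' ℝ)] with τ hτ using key τ hτ)
  simp only [zero_div, zero_mul, sub_zero] at this
  linarith

/-- The Yosida approximation of index `l` of the subdifferential of `Φ`. -/
def yosida (Φ : H → EReal) (l : ℝ) (x : H) : H :=
  Classical.epsilon fun q => IsSubgrad Φ (x - l • q) q

lemma isSubgrad_yosida [CompleteSpace H] {Φ : H → EReal}
    (hΦ : IsProperConvexLsc Φ) (hne : (argminSet Φ).Nonempty) {l : ℝ} (hl : 0 < l) (x : H) :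
    IsSubgrad Φ (x - l • yosida Φ l x) (yosida Φ l x) :=
  Classical.epsilon_spec (hΦ.exists_isSubgrad hne hl x)

lemma IsSubgrad.moreau_eq {Φ : H → EReal} (hΦ : IsProperConvexLsc Φ) {l : ℝ} (hl : 0 < l)
    {x q : H} (h : IsSubgrad Φ (x - l • q) q) :
    moreau Φ l x = (Φ (x - l • q)).toReal + l / 2 * ‖q‖ ^ 2 := by
  obtain ⟨hp, hs⟩ := h
  have key : (⨅ y : H, Φ y + ((1 / (2 * l) * ‖x - y‖ ^ 2 : ℝ) : EReal)) =
      (((Φ (x - l • q)).toReal + l / 2 * ‖q‖ ^ 2 : ℝ) : EReal) := by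
    apply le_antisymm
    · refine (iInf_le _ (x - l • q)).trans (le_of_eq ?_)
      rw [EReal.coe_add, hΦ.coe_toReal hp, sub_sub_cancel, norm_smul, Real.norm_of_nonneg hl.le]
      congr 2
      field_simp
    · refine le_iInf fun z => ?_
      by_cases hz : Φ z = ⊤
      · rw [hz, EReal.top_add_coe]; exact le_top
      rw [← hΦ.coe_toReal hz, ← EReal.coe_add, EReal.coe_le_coe_iff]
      have h1 := hs z hz
      have h2 : ‖x - z‖ ^ 2 = ‖l • q - (z - (x - l • q))‖ ^ 2 := by congr 2; module
      rw [h2, norm_sub_sq_real, real_inner_smul_left, norm_smul, Real.norm_of_nonneg hl.le]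
      have h3 : 1 / (2 * l) * ((l * ‖q‖) ^ 2 - 2 * (l * ⟪q, z - (x - l • q)⟫_ℝ)
          + ‖z - (x - l • q)‖ ^ 2) = l / 2 * ‖q‖ ^ 2 - ⟪q, z - (x - l • q)⟫_ℝ
          + 1 / (2 * l) * ‖z - (x - l • q)‖ ^ 2 := by field_simp
      have h4 : 0 ≤ 1 / (2 * l) * ‖z - (x - l • q)‖ ^ 2 := by positivity
      linarith
  rw [moreau, key, EReal.toReal_coe]

/-- The subgradient inequality at the two proximal points, with the quadratic terms rearranged
exactly. Equal indices give convexity of the envelope; exchanging the two points gives the matching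
upper bound needed for differentiability. -/
lemma IsSubgrad.moreau_ge {Φ : H → EReal} (hΦ : IsProperConvexLsc Φ) {l l' : ℝ} (hl : 0 < l)
    (hl' : 0 < l') {x x' q q' : H} (h : IsSubgrad Φ (x - l • q) q)
    (h' : IsSubgrad Φ (x' - l' • q') q') :
    moreau Φ l x + ⟪q, x' - x⟫_ℝ - (l' - l) / 2 * ‖q‖ ^ 2 + l' / 2 * ‖q' - q‖ ^ 2 ≤
      moreau Φ l' x' := by
  rw [h.moreau_eq hΦ hl, h'.moreau_eq hΦ hl']
  have h1 := h.2 _ h'.1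
  have h2 : x' - l' • q' - (x - l • q) = (x' - x) - l' • q' + l • q := by module
  rw [h2, inner_add_right, inner_sub_right, real_inner_smul_right, real_inner_smul_right,
    real_inner_self_eq_norm_sq] at h1
  rw [norm_sub_sq_real, real_inner_comm q q']
  linarith

lemma IsSubgrad.monotone {Φ : H → EReal} {p q p' q' : H} (h : IsSubgrad Φ p q)
    (h' : IsSubgrad Φ p' q') : 0 ≤ ⟪q' - q, p' - p⟫_ℝ := by
  have h1 := h.2 _ h'.1
  have h2 := h'.2 _ h.1
  rw [← neg_sub, inner_neg_right] at h2
  rw [inner_sub_left]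
  linarith

/-- Monotonicity of the subdifferential at the two proximal points. The inner product form is kept
because it is sharper than the Lipschitz bound drawn from it, and `norm_regMin_sub_le` relies on it.
-/
lemma IsSubgrad.mul_norm_sub_sq_le {Φ : H → EReal} {l l' : ℝ} {x x' q q' : H}
    (h : IsSubgrad Φ (x - l • q) q) (h' : IsSubgrad Φ (x' - l' • q') q') :
    l' * ‖q' - q‖ ^ 2 ≤ ⟪q' - q, x' - x⟫_ℝ - (l' - l) * ⟪q' - q, q⟫_ℝ := by
  have h1 := h.monotone h'
  have h2 : x' - l' • q' - (x - l • q) = (x' - x) - l' • (q' - q) - (l' - l) • q := by module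
  rw [h2, inner_sub_right, inner_sub_right, real_inner_smul_right, real_inner_smul_right,
    real_inner_self_eq_norm_sq] at h1
  linarith

lemma IsSubgrad.mul_norm_sub_le {Φ : H → EReal} {l l' : ℝ} {x x' q q' : H}
    (h : IsSubgrad Φ (x - l • q) q) (h' : IsSubgrad Φ (x' - l' • q') q') :
    l' * ‖q' - q‖ ≤ ‖x' - x‖ + |l' - l| * ‖q‖ := by
  have h1 := h.mul_norm_sub_sq_le h'
  rcases (norm_nonneg (q' - q)).eq_or_lt with h0 | h0
  · rw [← h0, mul_zero]; positivity
  refine le_of_mul_le_mul_right ?_ h0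
  have h2 := real_inner_le_norm (q' - q) (x' - x)
  have h4 : -((l' - l) * ⟪q' - q, q⟫_ℝ) ≤ |l' - l| * (‖q' - q‖ * ‖q‖) := by
    refine (neg_le_abs _).trans ?_
    rw [abs_mul]
    gcongr
    exact abs_real_inner_le_norm _ _
  nlinarith

end Prox

/-! ### Differentiability of the Moreau envelope -/

section Moreau

variable {H : Type*} [NormedAddCommGroup H] [InnerProductSpace ℝ H]

lemma IsSubgrad.eq_of_eq {Φ : H → EReal} {l : ℝ} (hl : 0 < l) {x q q' : H}
    (h : IsSubgrad Φ (x - l • q) q) (h' : IsSubgrad Φ (x - l • q') q') : q' = q := by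
  have h1 := h.mul_norm_sub_le h'
  simp only [sub_self, norm_zero, abs_zero, zero_mul, add_zero] at h1
  have h2 : ‖q' - q‖ ≤ 0 := by
    by_contra! h3
    exact absurd h1 (not_le.2 (mul_pos hl h3))
  exact sub_eq_zero.1 (norm_le_zero_iff.1 h2)

variable [CompleteSpace H]

lemma yosida_eq {Φ : H → EReal} (hΦ : IsProperConvexLsc Φ) (hne : (argminSet Φ).Nonempty)
    {l : ℝ} (hl : 0 < l) {x q : H} (h : IsSubgrad Φ (x - l • q) q) : yosida Φ l x = q :=
  h.eq_of_eq hl (isSubgrad_yosida hΦ hne hl x)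

lemma continuousAt_yosida {Φ : H → EReal} (hΦ : IsProperConvexLsc Φ)
    (hne : (argminSet Φ).Nonempty) {l : ℝ} (hl : 0 < l) (x : H) :
    ContinuousAt (fun p : ℝ × H => yosida Φ p.1 p.2) (l, x) := by
  rw [ContinuousAt, tendsto_iff_norm_sub_tendsto_zero]
  have hlim : ContinuousAt (fun p : ℝ × H =>
      (‖p.2 - x‖ + |p.1 - l| * ‖yosida Φ l x‖) / p.1) (l, x) := by
    refine ContinuousAt.div (by fun_prop) (by fun_prop) hl.ne'
  have hlim' := hlim.tendsto
  simp only [sub_self, norm_zero, abs_zero, zero_mul, add_zero, zero_div] at hlim'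
  have hpos : ∀ᶠ p : ℝ × H in 𝓝 (l, x), 0 < p.1 :=
    (continuousAt_fst (p := (l, x))).eventually (lt_mem_nhds hl)
  refine squeeze_zero' (Eventually.of_forall fun _ => norm_nonneg _) ?_ hlim'
  filter_upwards [hpos] with p hp
  rw [le_div_iff₀ hp, mul_comm]
  exact (isSubgrad_yosida hΦ hne hl x).mul_norm_sub_le (isSubgrad_yosida hΦ hne hp p.2)

/-- Joint differentiability of the Moreau envelope in the index and in the point. -/
lemma hasFDerivAt_moreau {Φ : H → EReal} (hΦ : IsProperConvexLsc Φ)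
    (hne : (argminSet Φ).Nonempty) {l : ℝ} (hl : 0 < l) (x : H) :
    HasFDerivAt (fun p : ℝ × H => moreau Φ p.1 p.2)
      ((innerSL ℝ (yosida Φ l x)).comp (ContinuousLinearMap.snd ℝ ℝ H)
        - (‖yosida Φ l x‖ ^ 2 / 2) • ContinuousLinearMap.fst ℝ ℝ H) (l, x) := by
  rw [hasFDerivAt_iff_isLittleO, Asymptotics.isLittleO_iff]
  intro c hc
  have hcont := continuousAt_yosida hΦ hne hl x
  have hlim : ContinuousAt (fun p : ℝ × H => ‖yosida Φ p.1 p.2 - yosida Φ l x‖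
      + |‖yosida Φ p.1 p.2‖ ^ 2 - ‖yosida Φ l x‖ ^ 2| / 2) (l, x) := by fun_prop
  have hlim' := hlim.tendsto
  simp only [sub_self, norm_zero, abs_zero, zero_div, add_zero] at hlim'
  have hpos : ∀ᶠ p : ℝ × H in 𝓝 (l, x), 0 < p.1 :=
    (continuousAt_fst (p := (l, x))).eventually (lt_mem_nhds hl)
  filter_upwards [hpos, hlim'.eventually (gt_mem_nhds hc)] with p hp hpc
  have h := isSubgrad_yosida hΦ hne hl x
  have h' := isSubgrad_yosida hΦ hne hp p.2
  -- The comparison is used in both directions: `h1` makes the remainder nonnegative, `h2` bounds it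
  -- by the variation of q, which is small by continuity.
  have h1 := h.moreau_ge hΦ hl hp h'
  have h2 := h'.moreau_ge hΦ hp hl h
  set q := yosida Φ l x
  set q' := yosida Φ p.1 p.2
  have h3 : 0 ≤ p.1 / 2 * ‖q' - q‖ ^ 2 := by positivity
  have h4 : 0 ≤ l / 2 * ‖q - q'‖ ^ 2 := by positivity
  have h5 : ⟪q', x - p.2⟫_ℝ = -(⟪q' - q, p.2 - x⟫_ℝ + ⟪q, p.2 - x⟫_ℝ) := by
    rw [← inner_add_left, sub_add_cancel, ← inner_neg_right, neg_sub]
  have h6 : ⟪q' - q, p.2 - x⟫_ℝ ≤ ‖q' - q‖ * ‖p - (l, x)‖ :=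
    (real_inner_le_norm _ _).trans (by gcongr; exact norm_snd_le (p - (l, x)))
  have h7 : -((p.1 - l) / 2 * (‖q'‖ ^ 2 - ‖q‖ ^ 2)) ≤
      |‖q'‖ ^ 2 - ‖q‖ ^ 2| / 2 * ‖p - (l, x)‖ := by
    refine (neg_le_abs _).trans ?_
    rw [abs_mul, abs_div, abs_of_pos (two_pos : (0 : ℝ) < 2)]
    have : |p.1 - l| ≤ ‖p - (l, x)‖ := norm_fst_le (p - (l, x))
    calc _ = |‖q'‖ ^ 2 - ‖q‖ ^ 2| / 2 * |p.1 - l| := by ring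
      _ ≤ _ := by gcongr
  have h8 : (‖q' - q‖ + |‖q'‖ ^ 2 - ‖q‖ ^ 2| / 2) * ‖p - (l, x)‖ ≤ c * ‖p - (l, x)‖ := by
    gcongr
  simp only [_root_.sub_apply, ContinuousLinearMap.comp_apply,
    _root_.smul_apply, ContinuousLinearMap.coe_snd', ContinuousLinearMap.coe_fst',
    Prod.snd_sub, Prod.fst_sub, innerSL_apply_apply, smul_eq_mul]
  rw [Real.norm_of_nonneg (by linarith)]
  linarith

lemma hasGradientAt_moreau {Φ : H → EReal} (hΦ : IsProperConvexLsc Φ)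
    (hne : (argminSet Φ).Nonempty) {l : ℝ} (hl : 0 < l) (x : H) :
    HasGradientAt (moreau Φ l) (yosida Φ l x) x := by
  rw [hasGradientAt_iff_hasFDerivAt]
  have := (hasFDerivAt_moreau hΦ hne hl x).comp x (hasFDerivAt_prodMk_right l x)
  refine this.congr_fderiv ?_
  ext z
  simp

lemma gradient_moreau {Φ : H → EReal} (hΦ : IsProperConvexLsc Φ)
    (hne : (argminSet Φ).Nonempty) {l : ℝ} (hl : 0 < l) (x : H) :
    gradient (moreau Φ l) x = yosida Φ l x :=
  (hasGradientAt_moreau hΦ hne hl x).gradient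

lemma gradient_phi {Φ : H → EReal} (hΦ : IsProperConvexLsc Φ)
    (hne : (argminSet Φ).Nonempty) {l : ℝ} (hl : 0 < l) (e : ℝ) (x : H) :
    gradient (phi Φ e l) x = yosida Φ l x + e • x := by
  refine HasGradientAt.gradient ?_
  rw [hasGradientAt_iff_hasFDerivAt]
  have h1 := hasGradientAt_iff_hasFDerivAt.1 (hasGradientAt_moreau hΦ hne hl x)
  have h2 := ((hasStrictFDerivAt_norm_sq x).hasFDerivAt.const_mul e).mul_const (1 / 2)
  have h3 := h1.add h2
  refine (h3.congr_fderiv ?_).congr_of_eventuallyEq (Eventually.of_forall fun z => ?_)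
  · ext z
    simp
    ring
  · simp [phi]; ring

lemma hasDerivWithinAt_moreau {Φ : H → EReal} (hΦ : IsProperConvexLsc Φ)
    (hne : (argminSet Φ).Nonempty) {lam : ℝ → ℝ} {x : ℝ → H} {l' : ℝ} {x' : H} {s : Set ℝ} {t : ℝ}
    (hpos : 0 < lam t) (hl : HasDerivWithinAt lam l' s t) (hx : HasDerivWithinAt x x' s t) :
    HasDerivWithinAt (fun r => moreau Φ (lam r) (x r))
      (⟪yosida Φ (lam t) (x t), x'⟫_ℝ - l' / 2 * ‖yosida Φ (lam t) (x t)‖ ^ 2) s t := by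
  have := (hasFDerivAt_moreau hΦ hne hpos (x t)).comp_hasDerivWithinAt t (hl.prodMk hx)
  refine this.congr_deriv ?_
  simp
  ring

lemma continuousOn_yosida {Φ : H → EReal} (hΦ : IsProperConvexLsc Φ)
    (hne : (argminSet Φ).Nonempty) {lam : ℝ → ℝ} {x : ℝ → H} {s : Set ℝ}
    (hpos : ∀ t ∈ s, 0 < lam t) (hl : ContinuousOn lam s) (hx : ContinuousOn x s) :
    ContinuousOn (fun t => yosida Φ (lam t) (x t)) s := fun t ht =>
  (continuousAt_yosida hΦ hne (hpos t ht) (x t)).comp_continuousWithinAt (f := fun r => (lam r, x r))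
    ((hl t ht).prodMk (hx t ht))

lemma exists_lipschitzOnWith_yosida {Φ : H → EReal} (hΦ : IsProperConvexLsc Φ)
    (hne : (argminSet Φ).Nonempty) {lam : ℝ → ℝ} {x : ℝ → H} {a b : ℝ}
    (hpos : ∀ t ∈ Icc a b, 0 < lam t) {K₁ K₂ : NNReal} (hl : LipschitzOnWith K₁ lam (Icc a b))
    (hx : LipschitzOnWith K₂ x (Icc a b)) :
    ∃ K, LipschitzOnWith K (fun t => yosida Φ (lam t) (x t)) (Icc a b) := by
  obtain ⟨C, hC⟩ := isCompact_Icc.exists_bound_of_continuousOn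
    (continuousOn_yosida hΦ hne hpos hl.continuousOn hx.continuousOn)
  obtain ⟨C', hC'⟩ := isCompact_Icc.exists_bound_of_continuousOn
    (hl.continuousOn.inv₀ fun t ht => (hpos t ht).ne')
  refine ⟨Real.toNNReal (C' * (K₂ + K₁ * C)), LipschitzOnWith.of_dist_le' fun t ht s hs => ?_⟩
  have h := (isSubgrad_yosida hΦ hne (hpos s hs) (x s)).mul_norm_sub_le
    (isSubgrad_yosida hΦ hne (hpos t ht) (x t))
  have h1 := hl.dist_le_mul t ht s hs
  have h2 := hx.dist_le_mul t ht s hs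
  rw [dist_eq_norm] at h1 h2 ⊢
  rw [Real.norm_eq_abs] at h1
  have h3 := hC s hs
  have h4 : (lam t)⁻¹ ≤ C' := (le_abs_self _).trans (hC' t ht)
  have h5 : 0 ≤ (lam t)⁻¹ := (inv_pos.2 (hpos t ht)).le
  calc _ = (lam t)⁻¹ * (lam t * ‖yosida Φ (lam t) (x t) - yosida Φ (lam s) (x s)‖) := by
        rw [inv_mul_cancel_left₀ (hpos t ht).ne']
    _ ≤ C' * (K₂ * dist t s + K₁ * dist t s * C) := by
        have h6 : 0 ≤ C' := h5.trans h4
        refine mul_le_mul h4 (h.trans (by gcongr)) ?_ h6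
        exact mul_nonneg (hpos t ht).le (norm_nonneg _)
    _ = _ := by ring

/-! ### The regularized minimizer -/

section RegMin

variable {Φ : H → EReal} {e l : ℝ}

lemma phi_ge (hΦ : IsProperConvexLsc Φ) (hne : (argminSet Φ).Nonempty) (e : ℝ) (hl : 0 < l)
    (x z : H) : phi Φ e l x + ⟪yosida Φ l x + e • x, z - x⟫_ℝ + e / 2 * ‖z - x‖ ^ 2 ≤
      phi Φ e l z := by
  have h := (isSubgrad_yosida hΦ hne hl x).moreau_ge hΦ hl hl (isSubgrad_yosida hΦ hne hl z)
  have h1 : 0 ≤ l / 2 * ‖yosida Φ l z - yosida Φ l x‖ ^ 2 := by positivity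
  have h2 : e * ‖z‖ ^ 2 / 2 = e * ‖x‖ ^ 2 / 2 + ⟪e • x, z - x⟫_ℝ + e / 2 * ‖z - x‖ ^ 2 := by
    rw [norm_sub_sq_real, real_inner_smul_left, inner_sub_right, real_inner_self_eq_norm_sq,
      real_inner_comm]
    ring
  rw [phi, phi, inner_add_left, h2]
  linarith

/-- The candidate for the minimizer of `phi Φ e l` given by the proximal point of the origin. -/
lemma yosida_neg_smul (hΦ : IsProperConvexLsc Φ) (hne : (argminSet Φ).Nonempty) (he : 0 < e)
    (hl : 0 < l) : yosida Φ l (-(1 / e) • yosida Φ (1 / e + l) 0) = yosida Φ (1 / e + l) 0 := by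
  have h := isSubgrad_yosida hΦ hne (show 0 < 1 / e + l by positivity) 0
  refine yosida_eq hΦ hne hl ?_
  convert h using 1
  module

lemma regMin_eq (hΦ : IsProperConvexLsc Φ) (hne : (argminSet Φ).Nonempty) (he : 0 < e)
    (hl : 0 < l) : regMin Φ e l = -(1 / e) • yosida Φ (1 / e + l) 0 := by
  set y := -(1 / e) • yosida Φ (1 / e + l) 0 with hy
  have hgrad : yosida Φ l y + e • y = 0 := by
    rw [hy, yosida_neg_smul hΦ hne he hl, smul_smul, mul_neg, mul_one_div_cancel he.ne']
    simp
  have hge : ∀ z, phi Φ e l y + e / 2 * ‖z - y‖ ^ 2 ≤ phi Φ e l z := fun z => by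
    simpa [hgrad] using phi_ge hΦ hne e hl y z
  have hex : ∃ z, z ∈ (univ : Set H) ∧ IsMinOn (phi Φ e l) univ z := by
    refine ⟨y, mem_univ _, fun z _ => ?_⟩
    have h1 := hge z
    have h2 : 0 ≤ e / 2 * ‖z - y‖ ^ 2 := by positivity
    show phi Φ e l y ≤ phi Φ e l z
    linarith
  have hspec : regMin Φ e l ∈ (univ : Set H) ∧ IsMinOn (phi Φ e l) univ (regMin Φ e l) :=
    Classical.epsilon_spec hex
  have h1 : phi Φ e l (regMin Φ e l) ≤ phi Φ e l y := hspec.2 (mem_univ y)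
  have h2 := hge (regMin Φ e l)
  have h3 : e / 2 * ‖regMin Φ e l - y‖ ^ 2 ≤ 0 := by linarith
  have h4 : ‖regMin Φ e l - y‖ ^ 2 ≤ 0 := by
    by_contra! h5
    exact absurd h3 (not_le.2 (by positivity))
  exact sub_eq_zero.1 (norm_eq_zero.1 (pow_eq_zero_iff two_ne_zero |>.1
    (le_antisymm h4 (by positivity))))

lemma yosida_regMin (hΦ : IsProperConvexLsc Φ) (hne : (argminSet Φ).Nonempty) (he : 0 < e)
    (hl : 0 < l) : yosida Φ (1 / e + l) 0 = -(e • regMin Φ e l) := by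
  rw [regMin_eq hΦ hne he hl, smul_smul, mul_neg, mul_one_div_cancel he.ne']
  simp

/-- Both sides have the same proximal point -(1/e + l)q, and the quadratic terms e‖y‖²/2 and l‖q‖²/2
add up to (1/e + l)‖q‖²/2. This is what makes the minimum value differentiable in the parameters. -/
lemma phi_regMin (hΦ : IsProperConvexLsc Φ) (hne : (argminSet Φ).Nonempty) (he : 0 < e)
    (hl : 0 < l) : phi Φ e l (regMin Φ e l) = moreau Φ (1 / e + l) 0 := by
  have hk : 0 < 1 / e + l := by positivity
  have h := isSubgrad_yosida hΦ hne hk 0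
  have h' : IsSubgrad Φ (-(1 / e) • yosida Φ (1 / e + l) 0 - l • yosida Φ (1 / e + l) 0)
      (yosida Φ (1 / e + l) 0) := by
    convert h using 1
    module
  rw [regMin_eq hΦ hne he hl, phi, h'.moreau_eq hΦ hl, h.moreau_eq hΦ hk, norm_smul, norm_neg,
    Real.norm_of_nonneg (by positivity)]
  have : -(1 / e) • yosida Φ (1 / e + l) 0 - l • yosida Φ (1 / e + l) 0
    = 0 - (1 / e + l) • yosida Φ (1 / e + l) 0 := by module
  rw [this]
  field_simp
  ring

lemma regMin_le (hΦ : IsProperConvexLsc Φ) (hne : (argminSet Φ).Nonempty) (he : 0 < e)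
    (hl : 0 < l) (x : H) : phi Φ e l (regMin Φ e l) ≤ phi Φ e l x := by
  have h := phi_ge hΦ hne e hl (regMin Φ e l) x
  have hgrad : yosida Φ l (regMin Φ e l) + e • regMin Φ e l = 0 := by
    rw [regMin_eq hΦ hne he hl, yosida_neg_smul hΦ hne he hl, smul_smul, mul_neg,
      mul_one_div_cancel he.ne']
    simp
  rw [hgrad, inner_zero_left] at h
  have : 0 ≤ e / 2 * ‖x - regMin Φ e l‖ ^ 2 := by positivity
  linarith

/-- Monotonicity between 0 ∈ ∂Φ(z) and the Yosida point q at the origin gives (1/e + l)‖q‖ ≤ ‖z‖,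
and the minimizer has norm ‖q‖/e. -/
lemma norm_regMin_le (hΦ : IsProperConvexLsc Φ) (hne : (argminSet Φ).Nonempty) (he : 0 < e)
    (hl : 0 < l) {z : H} (hz : z ∈ argminSet Φ) : ‖regMin Φ e l‖ ≤ ‖z‖ := by
  have hk : 0 < 1 / e + l := by positivity
  have hz' : IsSubgrad Φ z 0 := by
    obtain ⟨w, hw⟩ := hΦ.exists_ne_top
    refine ⟨fun h => hw (top_le_iff.1 (h ▸ hz w)), fun y hy => ?_⟩
    rw [inner_zero_left, add_zero]
    exact EReal.toReal_le_toReal (hz y) (hΦ.ne_bot _) hy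
  have h := hz'.monotone (isSubgrad_yosida hΦ hne hk 0)
  set q := yosida Φ (1 / e + l) 0 with hq
  rw [sub_zero, zero_sub, inner_sub_right, inner_neg_right, real_inner_smul_right,
    real_inner_self_eq_norm_sq] at h
  have h1 := neg_le_of_abs_le (abs_real_inner_le_norm q z)
  rw [regMin_eq hΦ hne he hl, ← hq, norm_smul, norm_neg, Real.norm_of_nonneg (by positivity)]
  rcases (norm_nonneg q).eq_or_lt with h0 | h0
  · rw [← h0]; simp
  refine le_of_mul_le_mul_right ?_ h0
  have h2 : 0 ≤ l * ‖q‖ ^ 2 := by positivity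
  linarith

end RegMin

lemma minNormSol_mem {Φ : H → EReal} (hΦ : IsProperConvexLsc Φ) (hne : (argminSet Φ).Nonempty) :
    minNormSol Φ ∈ argminSet Φ := by
  obtain ⟨z₀, hz₀⟩ := hne
  have hset : argminSet Φ = {z | Φ z ≤ Φ z₀} :=
    Set.ext fun z => ⟨fun h => h z₀, fun h y => h.trans (hz₀ y)⟩
  have hclosed : IsClosed (argminSet Φ) := by
    rw [hset]; exact hΦ.lsc.isClosed_preimage _
  obtain ⟨w, hw⟩ := hΦ.exists_ne_top
  have hfin : ∀ z ∈ argminSet Φ, Φ z ≠ ⊤ := fun z hz h => hw (top_le_iff.1 (h ▸ hz w))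
  have hconv : Convex ℝ (argminSet Φ) := by
    refine convex_iff_forall_pos.2 fun x hx y hy a b ha hb hab z => ?_
    obtain ⟨h1, h2⟩ := hΦ.toReal_convex (hfin x hx) (hfin y hy) ha hb hab
    by_cases hz : Φ z = ⊤
    · rw [hz]; exact le_top
    have h3 := EReal.toReal_le_toReal (hx z) (hΦ.ne_bot _) hz
    have h4 := EReal.toReal_le_toReal (hy z) (hΦ.ne_bot _) hz
    rw [← hΦ.coe_toReal hz]
    refine hΦ.le_coe_iff.2 ⟨h1, h2.trans ?_⟩
    calc _ ≤ a * (Φ z).toReal + b * (Φ z).toReal := by gcongr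
      _ = _ := by rw [← add_mul, hab, one_mul]
  obtain ⟨v, hv, hmin⟩ := exists_norm_eq_iInf_of_complete_convex ⟨z₀, hz₀⟩ hclosed.isComplete hconv 0
  have hex : ∃ z, z ∈ argminSet Φ ∧ IsMinOn (fun z : H => ‖z‖) (argminSet Φ) z := by
    refine ⟨v, hv, fun z hz => ?_⟩
    have h1 : (⨅ w : argminSet Φ, ‖0 - (w : H)‖) ≤ ‖0 - z‖ :=
      ciInf_le ⟨0, by rintro _ ⟨w, rfl⟩; exact norm_nonneg _⟩ (⟨z, hz⟩ : argminSet Φ)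
    rw [← hmin] at h1
    simpa using h1
  exact (Classical.epsilon_spec hex).1

end Moreau

/-! ### Pointwise inequalities for the energy -/

section PointwiseEstimates

variable {H : Type*} [NormedAddCommGroup H] [InnerProductSpace ℝ H]

lemma inner_le_young {k : ℝ} (hk : 0 < k) (p r : H) :
    ⟪p, r⟫_ℝ ≤ k / 2 * ‖p‖ ^ 2 + 1 / (2 * k) * ‖r‖ ^ 2 := by
  have h1 := real_inner_le_norm p r
  have h2 : k / 2 * ‖p‖ ^ 2 + 1 / (2 * k) * ‖r‖ ^ 2 - ‖p‖ * ‖r‖ =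
      1 / (2 * k) * (k * ‖p‖ - ‖r‖) ^ 2 := by field_simp; ring
  have h3 : 0 ≤ 1 / (2 * k) * (k * ‖p‖ - ‖r‖) ^ 2 := by positivity
  linarith

lemma neg_inner_le_young {k : ℝ} (hk : 0 < k) (p r : H) :
    -⟪p, r⟫_ℝ ≤ k / 2 * ‖p‖ ^ 2 + 1 / (2 * k) * ‖r‖ ^ 2 := by
  simpa [inner_neg_left] using inner_le_young hk (-p) r

/-- The pointwise inequality behind the energy estimate. Here `s = √ε`, `τ = -ε' / (2 ε)`, and `d`
plays the role of the time derivative of the regularized minimizer `y`. -/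
lemma energy_inequality {α β γ a c s τ dl L Δ : ℝ} {x y v q d : H} (hβ : 0 < β) (hγ : 0 < γ)
    (hγα : γ < α) (ha : 0 < a) (hc : 0 < c) (hs : 0 < s) (hτ : 0 ≤ τ) (hdl : 0 ≤ dl)
    (hΔ : 0 ≤ Δ) (hstrong : Δ + s ^ 2 / 2 * ‖x - y‖ ^ 2 ≤ ⟪q + s ^ 2 • x, x - y⟫_ℝ)
    (hd : ‖d‖ ≤ L * ‖y‖)
    (h0a : τ ≤ (2 * γ - α) * s + γ * β * s * τ)
    (h0b : τ ≤ s * (α - γ - γ / a))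
    (h1 : 2 * γ * (α - γ) + γ / c - 1 + 2 * β * τ ≤ 0)
    (h2 : β * s ^ 2 ≤ (2 - γ * β * s) * τ)
    (hsmall : s * (β ^ 2 * (α - γ) + β ^ 2 * (α - γ - γ / a) + γ * β ^ 2 / a
      + 3 * a / (2 * γ) * (β * (α - γ - γ / a)) ^ 2) ≤ β / 2) :
    ⟪q + s ^ 2 • x, v⟫_ℝ - dl / 2 * ‖q‖ ^ 2 - s ^ 2 * τ * ‖x‖ ^ 2
      + (s ^ 2 * τ + dl * s ^ 4 / 2) * ‖y‖ ^ 2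
      + ⟪(γ * s) • (x - y) + v + β • q,
          -(γ * s * τ) • (x - y) - ((α - γ) * s) • v - (γ * s) • d - (q + s ^ 2 • x)⟫_ℝ
      + ((α - γ) * s + τ) * (Δ + 1 / 2 * ‖(γ * s) • (x - y) + v + β • q‖ ^ 2)
      + β / 2 * ‖q + s ^ 2 • x‖ ^ 2 ≤
    (dl * s ^ 4 + 2 * s ^ 2 * τ - γ * β * s ^ 3 * τ + γ * (2 * a + c * γ) * s * L ^ 2)
      * ‖y‖ ^ 2 / 2 := by
  obtain ⟨u, rfl⟩ : ∃ u, x = y + u := ⟨x - y, by abel⟩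
  rw [add_sub_cancel_left] at *
  have hC0 : 0 ≤ α - γ - γ / a := nonneg_of_mul_nonneg_right (hτ.trans h0b) hs
  have hαγ : 0 < α - γ := sub_pos.2 hγα
  set C := α - γ - γ / a with hC
  -- The second weight comes from completing -γβsτ⟪u, q⟫ to the full gradient. The compensating
  -- γβs³τ⟪x, u⟫, polarized, yields the -γβs³τ‖y‖²/2 on the right-hand side and the factor 2 - γβs
  -- of `h2`.
  have f1 : 0 ≤ (γ * s + γ * β * s * τ) *
      (⟪q + s ^ 2 • (y + u), u⟫_ℝ - Δ - s ^ 2 / 2 * ‖u‖ ^ 2) :=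
    mul_nonneg (by positivity) (by linarith)
  have f2 : 0 ≤ (γ * s + γ * β * s * τ - (α - γ) * s - τ) * Δ :=
    mul_nonneg (by linarith) hΔ
  -- The terms in d are split so that the weights 3a/4 + a/4 + cγ/2 give the coefficient 2a + cγ of
  -- the target. Half of s(γ/a)‖v‖² is available: one third is spent here and one sixth in `f6`.
  have f3 : -(γ * s) * ⟪d, v⟫_ℝ ≤ γ * s * (3 * a / 4 * ‖d‖ ^ 2) + s * (γ / a) / 3 * ‖v‖ ^ 2 := by
    have := mul_le_mul_of_nonneg_left (neg_inner_le_young (show 0 < 3 * a / 2 by positivity) d v)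
      (show 0 ≤ γ * s by positivity)
    calc _ = γ * s * -⟪d, v⟫_ℝ := by ring
      _ ≤ _ := this
      _ = _ := by field_simp; ring
  have f4 : -(γ * s) * (β * ⟪d, q⟫_ℝ) ≤
      γ * s * (a / 4 * ‖d‖ ^ 2) + s * (γ * β ^ 2 / a) * ‖q‖ ^ 2 := by
    have := mul_le_mul_of_nonneg_left
      (neg_inner_le_young (show 0 < a / (2 * β) by positivity) d q)
      (show 0 ≤ γ * s * β by positivity)
    calc _ = γ * s * β * -⟪d, q⟫_ℝ := by ring
      _ ≤ _ := this
      _ = _ := by field_simp; ring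
  have f5 : -(γ * s) * (γ * s * ⟪d, u⟫_ℝ) ≤
      γ * s * (c * γ / 2 * ‖d‖ ^ 2) + γ * s ^ 3 / 2 * (γ / c) * ‖u‖ ^ 2 := by
    have := mul_le_mul_of_nonneg_left
      (neg_inner_le_young (show 0 < c / s by positivity) d u)
      (show 0 ≤ γ * s * (γ * s) by positivity)
    calc _ = γ * s * (γ * s) * -⟪d, u⟫_ℝ := by ring
      _ ≤ _ := this
      _ = _ := by field_simp
  have f6 : τ * (β * ⟪v, q⟫_ℝ) ≤
      s * (γ / a) / 6 * ‖v‖ ^ 2 + s * (3 * a / (2 * γ) * (β * C) ^ 2) * ‖q‖ ^ 2 := by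
    have hcs : ⟪v, q⟫_ℝ ≤ ‖v‖ * ‖q‖ := real_inner_le_norm v q
    calc τ * (β * ⟪v, q⟫_ℝ) ≤ τ * (β * (‖v‖ * ‖q‖)) := by gcongr
      _ ≤ s * C * (β * (‖v‖ * ‖q‖)) := by gcongr
      _ = s * (γ / a) / 6 * ‖v‖ ^ 2 + s * (3 * a / (2 * γ) * (β * C) ^ 2) * ‖q‖ ^ 2
          - s * (γ / a) / 6 * (‖v‖ - 3 * a / γ * (β * C) * ‖q‖) ^ 2 := by field_simp; ring
      _ ≤ _ := sub_le_self _ (by positivity)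
  have f7 : β * γ * (α - γ) * s ^ 2 * ⟪u, q⟫_ℝ ≤
      (α - γ) * s * (γ ^ 2 * s ^ 2 / 2 * ‖u‖ ^ 2 + β ^ 2 / 2 * ‖q‖ ^ 2) := by
    have hcs : ⟪u, q⟫_ℝ ≤ ‖u‖ * ‖q‖ := real_inner_le_norm u q
    calc β * γ * (α - γ) * s ^ 2 * ⟪u, q⟫_ℝ ≤ β * γ * (α - γ) * s ^ 2 * (‖u‖ * ‖q‖) := by gcongr
      _ = (α - γ) * s * (γ ^ 2 * s ^ 2 / 2 * ‖u‖ ^ 2 + β ^ 2 / 2 * ‖q‖ ^ 2)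
          - (α - γ) * s / 2 * (γ * s * ‖u‖ - β * ‖q‖) ^ 2 := by ring
      _ ≤ _ := sub_le_self _ (by positivity)
  have f8 : γ * β * s * τ * ⟪u, q⟫_ℝ ≤ τ * (γ ^ 2 * s ^ 2 / 2 * ‖u‖ ^ 2 + β ^ 2 / 2 * ‖q‖ ^ 2) := by
    have hcs : ⟪u, q⟫_ℝ ≤ ‖u‖ * ‖q‖ := real_inner_le_norm u q
    calc γ * β * s * τ * ⟪u, q⟫_ℝ ≤ γ * β * s * τ * (‖u‖ * ‖q‖) := by gcongr
      _ = τ * (γ ^ 2 * s ^ 2 / 2 * ‖u‖ ^ 2 + β ^ 2 / 2 * ‖q‖ ^ 2)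
          - τ / 2 * (γ * s * ‖u‖ - β * ‖q‖) ^ 2 := by ring
      _ ≤ _ := sub_le_self _ (by positivity)
  have f9 : 0 ≤ (s * C - τ) * ‖v‖ ^ 2 := mul_nonneg (by linarith) (by positivity)
  have f10 : 0 ≤ (s * C - τ) * (β ^ 2 * ‖q‖ ^ 2) := mul_nonneg (by linarith) (by positivity)
  -- After β/2‖q + s²x‖² is moved across, a term -β/2‖q‖² remains; the smallness of s lets it absorb
  -- every other multiple of ‖q‖².
  have f11 : 0 ≤ (β / 2 - s * (β ^ 2 * (α - γ) + β ^ 2 * C + γ * β ^ 2 / a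
      + 3 * a / (2 * γ) * (β * C) ^ 2)) * ‖q‖ ^ 2 := mul_nonneg (by linarith) (by positivity)
  have f12 : 0 ≤ γ * s ^ 3 / 2 * (-(2 * γ * (α - γ) + γ / c - 1 + 2 * β * τ)) * ‖u‖ ^ 2 :=
    mul_nonneg (mul_nonneg (by positivity) (by linarith)) (by positivity)
  have f13 : 0 ≤ s ^ 2 / 2 * ((2 - γ * β * s) * τ - β * s ^ 2) * ‖y + u‖ ^ 2 :=
    mul_nonneg (mul_nonneg (by positivity) (by linarith)) (by positivity)
  have f14 : γ * (2 * a + c * γ) * s / 2 * ‖d‖ ^ 2 ≤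
      γ * (2 * a + c * γ) * s / 2 * (L ^ 2 * ‖y‖ ^ 2) := by
    rw [← mul_pow]; gcongr
  have f15 : 0 ≤ dl / 2 * ‖q‖ ^ 2 := by positivity
  have f16 : 0 ≤ γ * s ^ 3 * β * τ * ‖u‖ ^ 2 := by positivity
  have f17 : (α - γ) * ‖v‖ ^ 2 = C * ‖v‖ ^ 2 + γ / a * ‖v‖ ^ 2 := by rw [hC]; ring
  clear_value C
  simp only [← real_inner_self_eq_norm_sq, inner_add_left, inner_add_right, inner_sub_right,
    real_inner_smul_left, real_inner_smul_right, real_inner_comm u y,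
    real_inner_comm q y, real_inner_comm v y, real_inner_comm q u,
    real_inner_comm v u, real_inner_comm d u, real_inner_comm q v, real_inner_comm d v,
    real_inner_comm d q] at *
  set iuu := ⟪u, u⟫_ℝ
  set iyy := ⟪y, y⟫_ℝ
  set ivv := ⟪v, v⟫_ℝ
  set iqq := ⟪q, q⟫_ℝ
  set idd := ⟪d, d⟫_ℝ
  generalize γ / a = ga at *
  generalize γ / c = gc at *
  have f17' := congrArg (s * ·) f17
  beta_reduce at f17'
  linear_combination f1 + f2 + f3 + f4 + f5 + f6 + f7 + f8 + f9 / 2 + f10 + f11 + f12 + f13 + f14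
    + f15 + f16 - f17' / 2

/-- A bound for the derivative of `‖u - ρ y‖² / 2` when `y` only satisfies a one-sided
Lipschitz estimate. -/
lemma exists_hasDerivAt_half_norm_sq_le {u y : ℝ → H} {ρ R N : ℝ → ℝ} {u' : H} {ρ' R' N' t : ℝ}
    (hu : HasDerivAt u u' t) (hρ : HasDerivAt ρ ρ' t) (hρ0 : ∀ᶠ r in 𝓝[>] t, 0 ≤ ρ r)
    (hy : ContinuousWithinAt y (Ioi t) t) (hR : ∀ᶠ r in 𝓝[>] t, ‖y r - y t‖ ≤ (r - t) * R r)
    (hR' : Tendsto R (𝓝[>] t) (𝓝 R')) (hR0 : 0 ≤ R')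
    (hN : HasDerivAt N N' t) (hNe : ∀ᶠ r in 𝓝[>] t, N r = 1 / 2 * ‖u r - ρ r • y r‖ ^ 2)
    (hNt : N t = 1 / 2 * ‖u t - ρ t • y t‖ ^ 2) :
    ∃ d : H, ‖d‖ ≤ R' ∧ N' ≤ ⟪u t - ρ t • y t, u' - ρ' • y t - ρ t • d⟫_ℝ := by
  set v : ℝ → H := fun r => u r - ρ r • y r with hv
  set U : ℝ → H := fun r => u r - ρ r • y t with hU
  have hUd : HasDerivAt U (u' - ρ' • y t) t := hu.sub (hρ.smul_const (y t))
  have hle : 𝓝[>] t ≤ 𝓝[≠] t := nhdsWithin_mono _ fun r hr => ne_of_gt hr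
  have hUs : Tendsto (slope U t) (𝓝[>] t) (𝓝 (u' - ρ' • y t)) :=
    (hasDerivAt_iff_tendsto_slope.1 hUd).mono_left hle
  have hNs : Tendsto (slope N t) (𝓝[>] t) (𝓝 N') :=
    (hasDerivAt_iff_tendsto_slope.1 hN).mono_left hle
  have hρc : Tendsto ρ (𝓝[>] t) (𝓝 (ρ t)) := hρ.continuousAt.tendsto.mono_left nhdsWithin_le_nhds
  have huc : Tendsto u (𝓝[>] t) (𝓝 (u t)) := hu.continuousAt.tendsto.mono_left nhdsWithin_le_nhds
  have hvc : Tendsto v (𝓝[>] t) (𝓝 (v t)) := huc.sub (hρc.smul hy)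
  -- The slope of N is dominated using ‖v r‖² - ‖v t‖² = ⟪v r + v t, v r - v t⟫, where only the norm
  -- of y r - y t is estimated.
  have hlim : Tendsto (fun r => 1 / 2 * ⟪v r + v t, slope U t r⟫_ℝ
      + 1 / 2 * (‖v r + v t‖ * (ρ r * R r))) (𝓝[>] t)
      (𝓝 (1 / 2 * ⟪v t + v t, u' - ρ' • y t⟫_ℝ + 1 / 2 * (‖v t + v t‖ * (ρ t * R')))) :=
    (((hvc.add_const (v t)).inner hUs).const_mul _).add
      (((hvc.add_const (v t)).norm.mul (hρc.mul hR')).const_mul _)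
  have hmain : N' ≤ ⟪v t, u' - ρ' • y t⟫_ℝ + ‖v t‖ * (ρ t * R') := by
    have hle2 := le_of_tendsto_of_tendsto hNs hlim (by
      filter_upwards [hρ0, hR, hNe, self_mem_nhdsWithin] with r h1 h2 h3 h4
      have h5 : 0 < r - t := sub_pos.2 h4
      rw [slope_def_field, slope_def_module, div_le_iff₀ h5, h3, hNt, real_inner_smul_right]
      have h6 : v r - v t = (U r - U t) - ρ r • (y r - y t) := by simp only [hv, hU]; module
      have h7 : ‖v r‖ ^ 2 - ‖v t‖ ^ 2 = ⟪v r + v t, v r - v t⟫_ℝ := by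
        have := real_inner_comm (v r) (v t)
        rw [inner_add_left, inner_sub_right (v r) (v r), inner_sub_right (v t) (v r),
          real_inner_self_eq_norm_sq, real_inner_self_eq_norm_sq]
        linarith
      rw [h6, inner_sub_right] at h7
      have h8 := neg_le_of_abs_le (abs_real_inner_le_norm (v r + v t) (ρ r • (y r - y t)))
      rw [norm_smul, Real.norm_of_nonneg h1] at h8
      have h9 : ‖v r + v t‖ * (ρ r * ‖y r - y t‖) ≤ ‖v r + v t‖ * (ρ r * ((r - t) * R r)) := by
        gcongr
      have h10 : (r - t) * (1 / 2 * ((r - t)⁻¹ * ⟪v r + v t, U r - U t⟫_ℝ)) =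
        1 / 2 * ⟪v r + v t, U r - U t⟫_ℝ := by field_simp
      change 1 / 2 * ‖v r‖ ^ 2 - 1 / 2 * ‖v t‖ ^ 2 ≤ _
      linarith)
    refine hle2.trans (le_of_eq ?_)
    rw [← two_smul ℝ (v t), real_inner_smul_left, norm_smul, Real.norm_of_nonneg zero_le_two]
    ring
  -- The worst direction, opposite to v t, turns the norm bound back into an inner product; for v t
  -- = 0 the convention 0⁻¹ = 0 gives d = 0.
  refine ⟨-(R' * ‖v t‖⁻¹) • v t, ?_, hmain.trans (le_of_eq ?_)⟩
  · rw [norm_smul, norm_neg, Real.norm_of_nonneg (by positivity), mul_assoc]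
    exact mul_le_of_le_one_right hR0 inv_mul_le_one
  · change _ = ⟪v t, _⟫_ℝ
    rw [inner_sub_right (v t) (u' - ρ' • y t), real_inner_smul_right, real_inner_smul_right,
      real_inner_self_eq_norm_sq]
    rcases eq_or_ne ‖v t‖ 0 with h | h
    · rw [h]; simp
    · field_simp
      ring

end PointwiseEstimates

/-! ### Motion of the regularized minimizer -/

section RegularizedMinimizer

variable {H : Type*} [NormedAddCommGroup H] [InnerProductSpace ℝ H]

lemma dt_hasDerivAt {F : Type*} [NormedAddCommGroup F] [NormedSpace ℝ F] {t₀ t : ℝ} {f : ℝ → F}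
    (hf : DifferentiableOn ℝ f (Ici t₀)) (ht : t₀ < t) : HasDerivAt f (dt t₀ f t) t :=
  (hf t ht.le).hasDerivWithinAt.hasDerivAt (Ici_mem_nhds ht)

lemma contDiffOn_one_Ici {F : Type*} [NormedAddCommGroup F] [NormedSpace ℝ F] {t₀ : ℝ}
    {f f' : ℝ → F} (hf : ∀ t, t₀ ≤ t → HasDerivWithinAt f (f' t) (Ici t₀) t)
    (hf' : ContinuousOn f' (Ici t₀)) : ContDiffOn ℝ 1 f (Ici t₀) := by
  have hu := uniqueDiffOn_Ici t₀
  rw [contDiffOn_one_iff_derivWithin hu]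
  refine ⟨fun t ht => (hf t ht).differentiableWithinAt, hf'.congr fun t ht => ?_⟩
  exact (hf t ht).derivWithin (hu t ht)

lemma absolutelyContinuousOnInterval_of_contDiffOn {F : Type*} [NormedAddCommGroup F]
    [NormedSpace ℝ F] {t₀ t T : ℝ} {f : ℝ → F} (hf : ContDiffOn ℝ 1 f (Ici t₀)) (ht : t₀ ≤ t)
    (hT : t ≤ T) : AbsolutelyContinuousOnInterval f t T := by
  refine (hf.mono ?_).absolutelyContinuousOnInterval
  rw [uIcc_of_le hT]
  exact Icc_subset_Ici_self.trans (Ici_subset_Ici.2 ht)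

lemma absolutelyContinuousOnInterval_norm_sq {F : Type*} [NormedAddCommGroup F]
    [NormedSpace ℝ F] {f : ℝ → F} {a b : ℝ} (hf : AbsolutelyContinuousOnInterval f a b) :
    AbsolutelyContinuousOnInterval (fun t => ‖f t‖ ^ 2) a b := by
  have h : AbsolutelyContinuousOnInterval (fun t => ‖f t‖) a b := by
    refine squeeze_zero (fun _ => Finset.sum_nonneg fun _ _ => dist_nonneg) (fun E => ?_) hf
    exact Finset.sum_le_sum fun i _ => lipschitzWith_one_norm.dist_le_mul _ _ |>.trans_eq (one_mul _)
  simpa only [sq] using h.fun_mul h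

section

variable [CompleteSpace H]

/-- With δ the increase of the index, monotonicity puts the increment w of the Yosida point q in the
ball with diameter from 0 to -(δ/κ')q. The first term is the radius of that ball after scaling by
1/e', the second the displacement of its centre, both per unit of ‖q‖. -/
lemma norm_regMin_sub_le {Φ : H → EReal} (hΦ : IsProperConvexLsc Φ) (hne : (argminSet Φ).Nonempty)
    {e l e' l' : ℝ} (he : 0 < e) (hl : 0 < l) (he' : 0 < e') (hl' : 0 < l')
    (hκ : 1 / e + l ≤ 1 / e' + l') :
    ‖regMin Φ e' l' - regMin Φ e l‖ ≤ ‖yosida Φ (1 / e + l) 0‖ *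
      ((1 / e' + l' - (1 / e + l)) / (2 * (1 / e' + l') * e') +
        |(1 / e' + l' - (1 / e + l)) / (2 * (1 / e' + l') * e') - (1 / e' - 1 / e)|) := by
  rw [regMin_eq hΦ hne he hl, regMin_eq hΦ hne he' hl']
  have hk : 0 < 1 / e + l := by positivity
  have hk' : 0 < 1 / e' + l' := by positivity
  have h := (isSubgrad_yosida hΦ hne hk 0).mul_norm_sub_sq_le (isSubgrad_yosida hΦ hne hk' 0)
  set κ := 1 / e + l
  set κ' := 1 / e' + l'
  set q := yosida Φ κ 0
  set q' := yosida Φ κ' 0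
  set δ := κ' - κ
  have hδ : 0 ≤ δ := sub_nonneg.2 hκ
  rw [sub_self, inner_zero_right, zero_sub] at h
  set w := q' - q with hw
  have h1 : ‖w + (δ / (2 * κ')) • q‖ ≤ δ / (2 * κ') * ‖q‖ := by
    refine le_of_sq_le_sq ?_ (by positivity)
    rw [norm_add_sq_real, real_inner_smul_right, norm_smul, Real.norm_of_nonneg (by positivity)]
    have h2 : ‖w‖ ^ 2 + δ / κ' * ⟪w, q⟫_ℝ ≤ 0 := by
      have : ‖w‖ ^ 2 + δ / κ' * ⟪w, q⟫_ℝ = 1 / κ' * (κ' * ‖w‖ ^ 2 + δ * ⟪w, q⟫_ℝ) := by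
        field_simp
      rw [this]
      exact mul_nonpos_of_nonneg_of_nonpos (by positivity) (by linarith)
    have h3 : 2 * (δ / (2 * κ') * ⟪w, q⟫_ℝ) = δ / κ' * ⟪w, q⟫_ℝ := by field_simp
    linarith
  have h2 : -(1 / e') • q' - -(1 / e) • q = -((1 / e') • (w + (δ / (2 * κ')) • q))
      + (δ / (2 * κ' * e') - (1 / e' - 1 / e)) • q := by
    have : q' = w + q := by rw [hw, sub_add_cancel]
    rw [this]
    match_scalars <;> field_simp
    ring
  rw [h2]
  refine (norm_add_le _ _).trans ?_
  rw [norm_neg, norm_smul, norm_smul, Real.norm_eq_abs (_ - _),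
    Real.norm_of_nonneg (by positivity : 0 ≤ 1 / e')]
  calc _ ≤ 1 / e' * (δ / (2 * κ') * ‖q‖) + |δ / (2 * κ' * e') - (1 / e' - 1 / e)| * ‖q‖ := by
        gcongr
    _ = _ := by field_simp

end

/-- The standing assumptions on the potential and on the parameter functions. -/
structure IsAdmissible (Φ : H → EReal) (t₀ : ℝ) (lam eps : ℝ → ℝ) : Prop where
  potential : IsProperConvexLsc Φ
  nonempty : (argminSet Φ).Nonempty
  lam_pos : ∀ t, t₀ ≤ t → 0 < lam t
  lam_contDiffOn : ContDiffOn ℝ 1 lam (Ici t₀)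
  lam_mono : MonotoneOn lam (Ici t₀)
  eps_pos : ∀ t, t₀ ≤ t → 0 < eps t
  eps_contDiffOn : ContDiffOn ℝ 1 eps (Ici t₀)
  eps_anti : AntitoneOn eps (Ici t₀)

namespace IsAdmissible

variable {Φ : H → EReal} {t₀ t : ℝ} {lam eps : ℝ → ℝ}

lemma hasDerivAt_lam (h : IsAdmissible Φ t₀ lam eps) (ht : t₀ < t) :
    HasDerivAt lam (dt t₀ lam t) t :=
  dt_hasDerivAt (h.lam_contDiffOn.differentiableOn one_ne_zero) ht

lemma hasDerivAt_eps (h : IsAdmissible Φ t₀ lam eps) (ht : t₀ < t) :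
    HasDerivAt eps (dt t₀ eps t) t :=
  dt_hasDerivAt (h.eps_contDiffOn.differentiableOn one_ne_zero) ht

lemma dt_lam_nonneg (h : IsAdmissible Φ t₀ lam eps) : 0 ≤ dt t₀ lam t :=
  h.lam_mono.derivWithin_nonneg

lemma dt_eps_nonpos (h : IsAdmissible Φ t₀ lam eps) : dt t₀ eps t ≤ 0 :=
  h.eps_anti.derivWithin_nonpos

lemma continuousOn_dt_lam (h : IsAdmissible Φ t₀ lam eps) : ContinuousOn (dt t₀ lam) (Ici t₀) :=
  h.lam_contDiffOn.continuousOn_derivWithin (uniqueDiffOn_Ici t₀) le_rfl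

lemma continuousOn_dt_eps (h : IsAdmissible Φ t₀ lam eps) : ContinuousOn (dt t₀ eps) (Ici t₀) :=
  h.eps_contDiffOn.continuousOn_derivWithin (uniqueDiffOn_Ici t₀) le_rfl

lemma contDiffOn_sqrt (h : IsAdmissible Φ t₀ lam eps) :
    ContDiffOn ℝ 1 (fun t => √(eps t)) (Ici t₀) :=
  h.eps_contDiffOn.sqrt fun t ht => (h.eps_pos t ht).ne'

lemma contDiffOn_one_div (h : IsAdmissible Φ t₀ lam eps) :
    ContDiffOn ℝ 1 (fun t => 1 / eps t) (Ici t₀) :=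
  contDiffOn_const.div h.eps_contDiffOn fun t ht => (h.eps_pos t ht).ne'

lemma contDiffOn_index (h : IsAdmissible Φ t₀ lam eps) :
    ContDiffOn ℝ 1 (fun t => 1 / eps t + lam t) (Ici t₀) :=
  h.contDiffOn_one_div.add h.lam_contDiffOn

lemma index_pos (h : IsAdmissible Φ t₀ lam eps) (ht : t₀ ≤ t) : 0 < 1 / eps t + lam t :=
  add_pos (one_div_pos.2 (h.eps_pos t ht)) (h.lam_pos t ht)

variable [CompleteSpace H]

lemma continuousOn_regMin (h : IsAdmissible Φ t₀ lam eps) :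
    ContinuousOn (fun t => regMin Φ (eps t) (lam t)) (Ici t₀) := by
  have h1 : ContinuousOn (fun t => -(1 / eps t) • yosida Φ (1 / eps t + lam t) 0) (Ici t₀) :=
    h.contDiffOn_one_div.continuousOn.neg.smul (continuousOn_yosida h.potential h.nonempty
      (fun t ht => h.index_pos ht) h.contDiffOn_index.continuousOn continuousOn_const)
  exact h1.congr fun t ht => regMin_eq h.potential h.nonempty (h.eps_pos t ht) (h.lam_pos t ht)

lemma hasDerivWithinAt_moreau_index (h : IsAdmissible Φ t₀ lam eps) {de dl : ℝ} {s : Set ℝ}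
    (ht : t₀ ≤ t) (hde : HasDerivWithinAt eps de s t) (hdl : HasDerivWithinAt lam dl s t) :
    HasDerivWithinAt (fun r => moreau Φ (1 / eps r + lam r) 0)
      ((de - dl * eps t ^ 2) / 2 * ‖regMin Φ (eps t) (lam t)‖ ^ 2) s t := by
  have he := h.eps_pos t ht
  have h1 := hasDerivWithinAt_moreau (lam := fun r => 1 / eps r + lam r) (x := fun _ => (0 : H))
    h.potential h.nonempty (h.index_pos ht)
    (((hasDerivWithinAt_const t s (1 : ℝ)).fun_div hde he.ne').fun_add hdl)
    (hasDerivWithinAt_const t s (0 : H))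
  refine h1.congr_deriv ?_
  rw [yosida_regMin h.potential h.nonempty he (h.lam_pos t ht), inner_zero_right, norm_neg,
    norm_smul, Real.norm_of_nonneg he.le]
  field_simp
  ring

/-- One-sided Lipschitz estimate for the regularized minimizer along the parameter functions. -/
lemma exists_regMin_bound (h : IsAdmissible Φ t₀ lam eps) (ht : t₀ < t) :
    ∃ (R : ℝ → ℝ) (R' : ℝ),
      (∀ᶠ r in 𝓝[>] t, ‖regMin Φ (eps r) (lam r) - regMin Φ (eps t) (lam t)‖ ≤ (r - t) * R r) ∧
      Tendsto R (𝓝[>] t) (𝓝 R') ∧ 0 ≤ R' ∧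
      R' ≤ (2 * dt t₀ lam t / lam t - dt t₀ eps t / eps t) * ‖regMin Φ (eps t) (lam t)‖ := by
  have he := h.eps_pos t ht.le
  have hl := h.lam_pos t ht.le
  set κ : ℝ → ℝ := fun r => 1 / eps r + lam r with hκ
  set ι : ℝ → ℝ := fun r => 1 / eps r with hι
  set q := yosida Φ (κ t) 0 with hq
  have hkt : 0 < κ t := h.index_pos ht.le
  have hde := h.hasDerivAt_eps ht
  have hdl := h.hasDerivAt_lam ht
  have hdι : HasDerivAt ι (-dt t₀ eps t / eps t ^ 2) t := by
    simpa [hι] using (hasDerivAt_const t (1 : ℝ)).fun_div hde he.ne'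
  have hdκ : HasDerivAt κ (-dt t₀ eps t / eps t ^ 2 + dt t₀ lam t) t := hdι.add hdl
  have hle : 𝓝[>] t ≤ 𝓝[≠] t := nhdsWithin_mono _ fun r hr => ne_of_gt hr
  have hsι := (hasDerivAt_iff_tendsto_slope.1 hdι).mono_left hle
  have hsκ := (hasDerivAt_iff_tendsto_slope.1 hdκ).mono_left hle
  have hcκ : Tendsto (fun r => 2 * κ r * eps r) (𝓝[>] t) (𝓝 (2 * κ t * eps t)) :=
    ((hdκ.continuousAt.const_mul 2).mul hde.continuousAt).tendsto.mono_left nhdsWithin_le_nhds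
  have hA := hsκ.div hcκ (by positivity)
  have hR := (hA.add (hA.sub hsι).abs).const_mul ‖q‖
  set e1 := -dt t₀ eps t / eps t with he1
  set l1 := dt t₀ lam t / lam t with hl1
  have he1n : 0 ≤ e1 := div_nonneg (neg_nonneg.2 h.dt_eps_nonpos) he.le
  have hl1n : 0 ≤ l1 := div_nonneg h.dt_lam_nonneg hl.le
  have hnq : ‖q‖ = eps t * ‖regMin Φ (eps t) (lam t)‖ := by
    rw [hq, hκ, yosida_regMin h.potential h.nonempty he hl, norm_neg, norm_smul,
      Real.norm_of_nonneg he.le]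
  refine ⟨_, _, ?_, hR, ?_, ?_⟩
  · filter_upwards [self_mem_nhdsWithin] with r hr
    have hr' : 0 < r - t := sub_pos.2 hr
    have htr : t₀ ≤ r := (ht.trans hr).le
    have hιr : 1 / eps t ≤ 1 / eps r :=
      one_div_le_one_div_of_le (h.eps_pos r htr) (h.eps_anti ht.le htr (le_of_lt hr))
    have hb := norm_regMin_sub_le h.potential h.nonempty he hl (h.eps_pos r htr)
      (h.lam_pos r htr) (add_le_add hιr (h.lam_mono ht.le htr (le_of_lt hr)))
    have h3 : (1 / eps r + lam r - (1 / eps t + lam t)) / (2 * (1 / eps r + lam r) * eps r)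
        = (r - t) * ((κ r - κ t) / (r - t) / (2 * κ r * eps r)) := by
      simp only [hκ]; field_simp
    have h4 : 1 / eps r - 1 / eps t = (r - t) * ((ι r - ι t) / (r - t)) := by
      simp only [hι]; field_simp
    rw [h3, h4, ← mul_sub, abs_mul, abs_of_pos hr'] at hb
    refine hb.trans (le_of_eq ?_)
    simp only [Pi.div_apply, slope_def_field]
    change ‖q‖ * _ = _
    ring
  · have := h.dt_eps_nonpos (t := t)
    have := h.dt_lam_nonneg (t := t)
    have : 0 ≤ -dt t₀ eps t / eps t ^ 2 := div_nonneg (by linarith) (by positivity)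
    positivity
  · have hk1 : -dt t₀ eps t / eps t ^ 2 + dt t₀ lam t = e1 / eps t + l1 * lam t := by
      rw [he1, hl1]; field_simp
    have hk2 : -dt t₀ eps t / eps t ^ 2 = e1 / eps t := by
      rw [he1]; field_simp
    -- m is the weighted mean of -ε'/ε and λ'/λ with weights 1 and λε, namely the logarithmic
    -- derivative of 1/ε + λ.
    set m := (e1 + l1 * (lam t * eps t)) / (1 + lam t * eps t) with hm
    have hden : 0 < 1 + lam t * eps t := by positivity
    have hm1 : m ≤ e1 + l1 := by
      rw [hm, div_le_iff₀ hden]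
      have : 0 ≤ e1 * (lam t * eps t) := by positivity
      linarith
    have hm0 : 0 ≤ m := by positivity
    have hk3 : (e1 / eps t + l1 * lam t) / (2 * κ t * eps t) = m / 2 / eps t := by
      rw [hm]; simp only [hκ]; field_simp
    have hL : 2 * dt t₀ lam t / lam t - dt t₀ eps t / eps t = 2 * l1 + e1 := by
      rw [he1, hl1]; ring
    rw [hk1, hk2, hk3, hL, ← sub_div, abs_div, abs_of_pos he, ← add_div, hnq]
    have habs : m / 2 + |m / 2 - e1| ≤ 2 * l1 + e1 := by
      rcases abs_cases (m / 2 - e1) with ⟨h1, _⟩ | ⟨h1, _⟩ <;> rw [h1] <;> linarith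
    calc _ = (m / 2 + |m / 2 - e1|) * ‖regMin Φ (eps t) (lam t)‖ := by field_simp
      _ ≤ _ := by gcongr

end IsAdmissible

end RegularizedMinimizer

/-! ### Regularity and differential inequality of the energy -/

section EnergyEstimate

variable {H : Type*} [NormedAddCommGroup H] [InnerProductSpace ℝ H] [CompleteSpace H]

lemma absolutelyContinuousOnInterval_congr {X : Type*} [PseudoMetricSpace X] {f g : ℝ → X}
    {a b : ℝ} (hf : AbsolutelyContinuousOnInterval f a b) (h : EqOn g f (uIcc a b)) :
    AbsolutelyContinuousOnInterval g a b := by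
  refine Tendsto.congr' ?_ hf
  refine eventually_inf_principal.2 (Eventually.of_forall fun E hE => ?_)
  refine Finset.sum_congr rfl fun i hi => ?_
  rw [h (hE.1 i hi).1, h (hE.1 i hi).2]

section Trajectory

variable {Φ : H → EReal} {α β γ a c t₀ t : ℝ} {lam eps : ℝ → ℝ} {x : ℝ → H}

lemma IsSolution.continuousOn_velocity (hx : IsSolution Φ α β t₀ lam eps x) :
    ContinuousOn (dt t₀ x) (Ici t₀) := by
  intro t ht
  have ht' : t₀ ≤ t := ht
  have h := (hx.velocity_ac (t + 1) (by linarith)).continuousOn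
  rw [uIcc_of_le (by linarith)] at h
  refine (h t ⟨ht, by linarith⟩).mono_of_mem_nhdsWithin ?_
  rw [← Ici_inter_Iic]
  exact inter_mem_nhdsWithin _ (Iic_mem_nhds (lt_add_one t))

lemma IsSolution.contDiffOn (hx : IsSolution Φ α β t₀ lam eps x) : ContDiffOn ℝ 1 x (Ici t₀) :=
  contDiffOn_one_Ici (fun t ht => (hx.differentiable t ht).hasDerivWithinAt)
    hx.continuousOn_velocity

namespace IsAdmissible

/-- The minimum value becomes an envelope at the origin, so the minimizer survives only in the last
term of the norm; everything outside the norm is C¹ along a solution. -/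
lemma energy_eq (h : IsAdmissible Φ t₀ lam eps) (ht : t₀ ≤ t) :
    energy Φ β γ t₀ lam eps x t =
      moreau Φ (lam t) (x t) + eps t * ‖x t‖ ^ 2 / 2 - moreau Φ (1 / eps t + lam t) 0
      + 1 / 2 * ‖(γ * √(eps t)) • x t + dt t₀ x t + β • yosida Φ (lam t) (x t)
        - (γ * √(eps t)) • regMin Φ (eps t) (lam t)‖ ^ 2 := by
  rw [energy, phi_regMin h.potential h.nonempty (h.eps_pos t ht) (h.lam_pos t ht),
    gradient_moreau h.potential h.nonempty (h.lam_pos t ht), phi]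
  congr 4
  module

lemma energy_nonneg (h : IsAdmissible Φ t₀ lam eps) (ht : t₀ ≤ t) :
    0 ≤ energy Φ β γ t₀ lam eps x t :=
  add_nonneg (sub_nonneg.2 (regMin_le h.potential h.nonempty (h.eps_pos t ht) (h.lam_pos t ht) _))
    (by positivity)

lemma contDiffOn_moreau (h : IsAdmissible Φ t₀ lam eps) (hx : IsSolution Φ α β t₀ lam eps x) :
    ContDiffOn ℝ 1 (fun t => moreau Φ (lam t) (x t)) (Ici t₀) := by
  have hq := continuousOn_yosida h.potential h.nonempty (s := Ici t₀) (fun t ht => h.lam_pos t ht)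
    h.lam_contDiffOn.continuousOn hx.contDiffOn.continuousOn
  refine contDiffOn_one_Ici (fun t ht => hasDerivWithinAt_moreau h.potential h.nonempty
    (h.lam_pos t ht)
    (h.lam_contDiffOn.differentiableOn one_ne_zero t ht).hasDerivWithinAt
    (hx.differentiable t ht).hasDerivWithinAt) ?_
  exact (hq.inner hx.continuousOn_velocity).sub
    ((h.continuousOn_dt_lam.div_const 2).mul (hq.norm.pow 2))

lemma contDiffOn_moreau_index (h : IsAdmissible Φ t₀ lam eps) :
    ContDiffOn ℝ 1 (fun t => moreau Φ (1 / eps t + lam t) 0) (Ici t₀) := by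
  refine contDiffOn_one_Ici (fun t ht => h.hasDerivWithinAt_moreau_index ht
    (h.eps_contDiffOn.differentiableOn one_ne_zero t ht).hasDerivWithinAt
    (h.lam_contDiffOn.differentiableOn one_ne_zero t ht).hasDerivWithinAt) ?_
  exact ((h.continuousOn_dt_eps.sub (h.continuousOn_dt_lam.mul
    (h.eps_contDiffOn.continuousOn.pow 2))).div_const 2).mul (h.continuousOn_regMin.norm.pow 2)

lemma absolutelyContinuousOnInterval_yosida (h : IsAdmissible Φ t₀ lam eps) {k : ℝ → ℝ} {z : ℝ → H}
    (hk : ContDiffOn ℝ 1 k (Ici t₀)) (hkpos : ∀ t, t₀ ≤ t → 0 < k t)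
    (hz : ContDiffOn ℝ 1 z (Ici t₀)) {T : ℝ} (ht : t₀ ≤ t) (hT : t ≤ T) :
    AbsolutelyContinuousOnInterval (fun s => yosida Φ (k s) (z s)) t T := by
  have hsub : Icc t T ⊆ Ici t₀ := Icc_subset_Ici_self.trans (Ici_subset_Ici.2 ht)
  obtain ⟨K₁, hK₁⟩ := (hk.mono hsub).exists_lipschitzOnWith one_ne_zero (convex_Icc _ _)
    isCompact_Icc
  obtain ⟨K₂, hK₂⟩ := (hz.mono hsub).exists_lipschitzOnWith one_ne_zero (convex_Icc _ _)
    isCompact_Icc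
  obtain ⟨K, hK⟩ := exists_lipschitzOnWith_yosida h.potential h.nonempty
    (fun s hs => hkpos s (hsub hs)) hK₁ hK₂
  rw [← uIcc_of_le hT] at hK
  exact hK.absolutelyContinuousOnInterval

lemma absolutelyContinuousOnInterval_energy (h : IsAdmissible Φ t₀ lam eps)
    (hx : IsSolution Φ α β t₀ lam eps x) {T : ℝ} (ht : t₀ ≤ t) (hT : t ≤ T) :
    AbsolutelyContinuousOnInterval (energy Φ β γ t₀ lam eps x) t T := by
  have hmem : ∀ s ∈ uIcc t T, t₀ ≤ s := fun s hs => by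
    rw [uIcc_of_le hT] at hs
    exact ht.trans hs.1
  have hρ : ContDiffOn ℝ 1 (fun s => γ * √(eps s)) (Ici t₀) := contDiffOn_const.mul h.contDiffOn_sqrt
  have hρ' := absolutelyContinuousOnInterval_of_contDiffOn hρ ht hT
  have hA := absolutelyContinuousOnInterval_of_contDiffOn (((h.contDiffOn_moreau hx).add
    ((h.eps_contDiffOn.mul (hx.contDiffOn.norm_sq ℝ)).div_const 2)).sub h.contDiffOn_moreau_index)
    ht hT
  have hρx := absolutelyContinuousOnInterval_of_contDiffOn (hρ.smul hx.contDiffOn) ht hT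
  have hv : AbsolutelyContinuousOnInterval (dt t₀ x) t T := by
    refine (hx.velocity_ac T (ht.trans hT)).mono ?_
    rw [uIcc_of_le hT, uIcc_of_le (ht.trans hT)]
    exact Icc_subset_Icc_left ht
  have hq := h.absolutelyContinuousOnInterval_yosida h.lam_contDiffOn h.lam_pos hx.contDiffOn ht hT
  have hy : AbsolutelyContinuousOnInterval (fun s => regMin Φ (eps s) (lam s)) t T := by
    refine absolutelyContinuousOnInterval_congr
      ((absolutelyContinuousOnInterval_of_contDiffOn h.contDiffOn_one_div.neg ht hT).fun_smul
        (h.absolutelyContinuousOnInterval_yosida h.contDiffOn_index (fun s hs => h.index_pos hs)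
          (contDiffOn_const (c := (0 : H))) ht hT)) fun s hs => ?_
    exact regMin_eq h.potential h.nonempty (h.eps_pos s (hmem s hs)) (h.lam_pos s (hmem s hs))
  have hN := absolutelyContinuousOnInterval_norm_sq
    (((hρx.fun_add hv).fun_add (hq.const_smul β)).fun_sub (hρ'.fun_smul hy))
  refine absolutelyContinuousOnInterval_congr (hA.fun_add (hN.const_mul (1 / 2))) fun s hs => ?_
  rw [h.energy_eq (hmem s hs)]
  rfl

lemma deriv_energy_le (h : IsAdmissible Φ t₀ lam eps) (hx : IsSolution Φ α β t₀ lam eps x)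
    (hβ : 0 < β) (hγ : 0 < γ) (hγα : γ < α) (ha : 0 < a) (hc : 0 < c) (ht : t₀ < t)
    (h0 : dt t₀ (fun s => 1 / √(eps s)) t ≤
      min (2 * γ - α - γ * β * dt t₀ eps t / (2 * eps t)) (α - γ * ((a + 1) / a)))
    (h1 : (2 * γ * (α - γ) + γ / c - 1) * eps t - β * dt t₀ eps t ≤ 0)
    (h2 : 2 * β * eps t ^ 2 + (2 - γ * β * √(eps t)) * dt t₀ eps t ≤ 0)
    (hsmall : √(eps t) * (β ^ 2 * (α - γ) + β ^ 2 * (α - γ - γ / a) + γ * β ^ 2 / a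
      + 3 * a / (2 * γ) * (β * (α - γ - γ / a)) ^ 2) ≤ β / 2)
    (heq : ∃ x'' w : H, HasDerivAt (dt t₀ x) x'' t ∧
      HasDerivAt (fun s => gradient (moreau Φ (lam s)) (x s)) w t ∧
      x'' + (α * √(eps t)) • dt t₀ x t + β • w
        + gradient (moreau Φ (lam t)) (x t) + eps t • x t = 0)
    (hE : DifferentiableAt ℝ (energy Φ β γ t₀ lam eps x) t) :
    deriv (energy Φ β γ t₀ lam eps x) t + mu α γ t₀ eps t * energy Φ β γ t₀ lam eps x t
      + β / 2 * ‖gradient (phi Φ (eps t) (lam t)) (x t)‖ ^ 2 ≤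
    gfun β γ a c t₀ lam eps t * ‖regMin Φ (eps t) (lam t)‖ ^ 2 / 2 := by
  obtain ⟨x'', w, hx'', hw, heq⟩ := heq
  have he := h.eps_pos t ht.le
  have hl := h.lam_pos t ht.le
  have hde := h.hasDerivAt_eps ht
  have hdl := h.hasDerivAt_lam ht
  have hdx := dt_hasDerivAt hx.differentiable ht
  have hs : 0 < √(eps t) := Real.sqrt_pos.2 he
  have hs2 : √(eps t) ^ 2 = eps t := Real.sq_sqrt he.le
  have hds : HasDerivAt (fun r => √(eps r)) (dt t₀ eps t / (2 * √(eps t))) t := hde.sqrt he.ne'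
  have hdis : dt t₀ (fun s => 1 / √(eps s)) t
      = -(dt t₀ eps t / (2 * √(eps t))) / √(eps t) ^ 2 := by
    have := ((hasDerivAt_const t (1 : ℝ)).fun_div hds hs.ne').hasDerivWithinAt (s := Ici t₀)
    rw [dt, this.derivWithin (uniqueDiffOn_Ici t₀ t ht.le)]
    ring
  rw [gradient_moreau h.potential h.nonempty hl] at heq
  have hw' : HasDerivAt (fun s => yosida Φ (lam s) (x s)) w t := by
    refine hw.congr_of_eventuallyEq ?_
    filter_upwards [Ioi_mem_nhds ht] with r hr
    exact (gradient_moreau h.potential h.nonempty (h.lam_pos r (le_of_lt hr)) _).symm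
  have hA := ((hasDerivWithinAt_moreau h.potential h.nonempty hl hdl.hasDerivWithinAt
    hdx.hasDerivWithinAt (s := univ)).fun_add
    (((hde.fun_mul hdx.norm_sq).div_const 2).hasDerivWithinAt)).fun_sub
    (h.hasDerivWithinAt_moreau_index ht.le hde.hasDerivWithinAt hdl.hasDerivWithinAt)
  rw [hasDerivWithinAt_univ] at hA
  -- The squared-norm part is differentiable at t as the difference of E and its C¹ part, although y
  -- need not be.
  have hN := hE.hasDerivAt.fun_sub hA
  have hρ : HasDerivAt (fun r => γ * √(eps r)) (γ * (dt t₀ eps t / (2 * √(eps t)))) t :=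
    hds.const_mul γ
  have hu := ((hρ.fun_smul hdx).fun_add hx'').fun_add (hw'.const_smul β)
  obtain ⟨R, R', hR, hRlim, hR0, hR'⟩ := h.exists_regMin_bound ht
  have hcy : ContinuousWithinAt (fun r => regMin Φ (eps r) (lam r)) (Ioi t) t :=
    (h.continuousOn_regMin t ht.le).mono (Ioi_subset_Ici ht.le)
  have hNe : ∀ r, t₀ ≤ r → energy Φ β γ t₀ lam eps x r - (moreau Φ (lam r) (x r)
      + eps r * ‖x r‖ ^ 2 / 2 - moreau Φ (1 / eps r + lam r) 0) =
      1 / 2 * ‖(γ * √(eps r)) • x r + dt t₀ x r + β • yosida Φ (lam r) (x r)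
        - (γ * √(eps r)) • regMin Φ (eps r) (lam r)‖ ^ 2 := fun r hr => by
    rw [h.energy_eq hr]; ring
  obtain ⟨d, hd, hle⟩ := exists_hasDerivAt_half_norm_sq_le hu hρ
    (Eventually.of_forall fun r => by positivity) hcy hR hRlim hR0 hN (by
      filter_upwards [self_mem_nhdsWithin] with r hr
      exact hNe r (ht.trans hr).le) (hNe t ht.le)
  have hstrong := phi_ge h.potential h.nonempty (eps t) hl (x t) (regMin Φ (eps t) (lam t))
  have hΔ := sub_nonneg.2 (regMin_le h.potential h.nonempty he hl (x t))
  rw [gradient_phi h.potential h.nonempty hl, mu, gfun, energy,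
    gradient_moreau h.potential h.nonempty hl]
  set Δ := phi Φ (eps t) (lam t) (x t) - phi Φ (eps t) (lam t) (regMin Φ (eps t) (lam t)) with hΔdef
  -- With τ = -ε'/(2ε) and s = √ε the derivative of 1/√ε is τ/s, and all parameter conditions become
  -- polynomial in s and τ up to constants.
  obtain ⟨τ, hτ⟩ : ∃ τ, dt t₀ eps t = -(2 * √(eps t) ^ 2 * τ) :=
    ⟨-dt t₀ eps t / (2 * √(eps t) ^ 2), by field_simp⟩
  have hde0 : dt t₀ eps t ≤ 0 := h.dt_eps_nonpos
  rw [hdis] at h0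
  have h0a := h0.trans (min_le_left _ _)
  have h0b := h0.trans (min_le_right _ _)
  have hdl0 : 0 ≤ dt t₀ lam t := h.dt_lam_nonneg
  clear_value Δ
  have hcoe : (β • fun s => yosida Φ (lam s) (x s)) t = β • yosida Φ (lam t) (x t) := rfl
  rw [hcoe] at hle
  rw [hτ] at h0a h0b h1 h2 hde0 hR' hle ⊢
  set y := regMin Φ (eps t) (lam t)
  set q := yosida Φ (lam t) (x t)
  clear_value y q
  clear hA hN hNe hcy hR hu hρ hds hdis hde hdl hdx hw' hw hx'' hE hRlim h0 hcoe
  have hs2' := hs2.symm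
  generalize √(eps t) = s at *
  rw [hs2'] at h0a h1 h2 hR' hstrong hle heq hΔdef ⊢
  generalize x t = X at *
  generalize dt t₀ x t = v at *
  generalize dt t₀ lam t = dl at *
  have hτ0 : 0 ≤ τ := by
    by_contra! hneg
    have : 0 < 2 * s ^ 2 * -τ := by have := neg_pos.2 hneg; positivity
    linarith
  have hcoef : -(-(2 * s ^ 2 * τ) / (2 * s)) / s ^ 2 = τ / s := by field_simp
  rw [hcoef, div_le_iff₀ hs] at h0a h0b
  have hq1 : γ * β * -(2 * s ^ 2 * τ) / (2 * s ^ 2) = -(γ * β * τ) := by field_simp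
  have hq2 : γ * ((a + 1) / a) = γ + γ / a := by field_simp
  have hq3 : -(2 * s ^ 2 * τ) / s ^ 2 = -(2 * τ) := by field_simp
  have hq4 : -(2 * s ^ 2 * τ) / (2 * s) = -(s * τ) := by field_simp
  have hq5 : -(2 * s ^ 2 * τ) / (2 * s ^ 2) = -τ := by field_simp
  rw [hq1] at h0a
  rw [hq2] at h0b
  rw [hq3] at hR' ⊢
  rw [hq4] at hle
  rw [hq5]
  have hx2 : (γ * s) • v + (γ * -(s * τ)) • X + x'' + β • w - (γ * -(s * τ)) • y - (γ * s) • d =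
      -(γ * s * τ) • (X - y) - ((α - γ) * s) • v - (γ * s) • d - (q + s ^ 2 • X) := by
    rw [← sub_eq_zero, ← heq]
    module
  have hx1 : (γ * s) • X + v + β • q - (γ * s) • y = (γ * s) • (X - y) + v + β • q := by module
  rw [hx1] at hle
  rw [hx2] at hle
  rw [← neg_sub X y, inner_neg_right, norm_neg] at hstrong
  have hs1 : 0 < s ^ 2 := by positivity
  have key := energy_inequality (x := X) (v := v) (q := q)
    (L := 2 * dl / lam t - -(2 * τ)) hβ hγ hγα ha hc hs hτ0 hdl0 hΔ
    (by linarith) (hd.trans hR') (by linarith) (by linarith)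
    (by
      refine le_of_mul_le_mul_left ?_ hs1
      linarith)
    (by
      refine le_of_mul_le_mul_left ?_ hs1
      linarith) hsmall
  rw [inner_add_left q, real_inner_smul_left] at key
  linarith

end IsAdmissible

end Trajectory

end EnergyEstimate

/-! ### Integration of the differential inequality -/

section Integration

lemma sub_le_integral_of_deriv_le {W r : ℝ → ℝ} {t₁ t : ℝ} (ht : t₁ ≤ t)
    (hW : AbsolutelyContinuousOnInterval W t₁ t) (hr : ContinuousOn r (Icc t₁ t))
    (h : ∀ᵐ s, t₁ < s → s ≤ t → deriv W s ≤ r s) : W t - W t₁ ≤ ∫ s in t₁..t, r s := by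
  rw [← hW.integral_deriv_eq_sub]
  rw [← uIcc_of_le ht] at hr
  refine intervalIntegral.integral_mono_ae_restrict ht hW.intervalIntegrable_deriv
    hr.intervalIntegrable ?_
  have hne : ∀ᵐ s : ℝ, s ≠ t₁ := by simp [ae_iff, measure_singleton]
  refine (ae_restrict_iff' measurableSet_Icc).2 ?_
  filter_upwards [h, hne] with s hs hst hmem
  exact hs (lt_of_le_of_ne hmem.1 hst.symm) hmem.2

lemma mul_integral_le_of_deriv_le {E μ g b : ℝ → ℝ} {K β t₁ t : ℝ} (ht : t₁ ≤ t)
    (hE : AbsolutelyContinuousOnInterval E t₁ t) (hE0 : ∀ s, t₁ ≤ s → 0 ≤ E s)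
    (hμ0 : ∀ s, t₁ ≤ s → 0 ≤ μ s) (hg : ContinuousOn g (Ici t₁)) (hb : ContinuousOn b (Ici t₁))
    (h : ∀ᵐ s, t₁ < s → deriv E s + μ s * E s + β / 2 * b s ≤ g s * K / 2) :
    β * ∫ s in t₁..t, b s ≤ 2 * E t₁ + K * ∫ s in t₁..t, g s := by
  have hg' : ContinuousOn g (uIcc t₁ t) := hg.mono (by rw [uIcc_of_le ht]; exact Icc_subset_Ici_self)
  have hb' : ContinuousOn b (uIcc t₁ t) := hb.mono (by rw [uIcc_of_le ht]; exact Icc_subset_Ici_self)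
  have h1 := sub_le_integral_of_deriv_le (r := fun s => K / 2 * g s - β / 2 * b s) ht hE
    (((hg.const_smul (K / 2)).sub (hb.const_smul (β / 2))).mono Icc_subset_Ici_self) (by
      filter_upwards [h] with s hs hst _
      have h2 := hs hst
      have h3 := mul_nonneg (hμ0 s hst.le) (hE0 s hst.le)
      linarith)
  rw [intervalIntegral.integral_sub (hg'.intervalIntegrable.const_mul _)
    (hb'.intervalIntegrable.const_mul _), intervalIntegral.integral_const_mul,
    intervalIntegral.integral_const_mul] at h1
  have h4 := hE0 t ht
  linarith

/-- Γ is an integrating factor: (ΓE)' = Γ(E' + μE) almost everywhere. The strict inequality t₀ < t₁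
makes Γ two-sidedly differentiable at t₁. -/
lemma le_of_deriv_add_mul_le {E μ g : ℝ → ℝ} {K t₀ t₁ t : ℝ} (ht₁ : t₀ < t₁) (ht : t₁ ≤ t)
    (hE : AbsolutelyContinuousOnInterval E t₁ t)
    (hμ : ContinuousOn μ (Ici t₀)) (hg : ContinuousOn g (Ici t₁))
    (h : ∀ᵐ s, t₁ < s → DifferentiableAt ℝ E s ∧ deriv E s + μ s * E s ≤ g s * K / 2) :
    E t ≤ K / (2 * Real.exp (∫ s in t₁..t, μ s))
        * (∫ s in t₁..t, Real.exp (∫ r in t₁..s, μ r) * g s)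
      + Real.exp (∫ s in t₁..t₁, μ s) * E t₁ / Real.exp (∫ s in t₁..t, μ s) := by
  set Γ : ℝ → ℝ := fun s => Real.exp (∫ r in t₁..s, μ r) with hΓ
  have hΓpos : ∀ s, 0 < Γ s := fun s => Real.exp_pos _
  have hΓd : ∀ s, t₁ ≤ s → HasDerivAt Γ (Γ s * μ s) s := by
    intro s hs
    have hint : IntervalIntegrable μ volume t₁ s := by
      refine (hμ.mono ?_).intervalIntegrable
      rw [uIcc_of_le hs]
      exact Icc_subset_Ici_self.trans (Ici_subset_Ici.2 ht₁.le)
    have hs' : s ∈ Ioi t₀ := ht₁.trans_le hs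
    exact (intervalIntegral.integral_hasDerivAt_right hint
      ((hμ.mono Ioi_subset_Ici_self).stronglyMeasurableAtFilter isOpen_Ioi s hs')
      (hμ.continuousAt (Ici_mem_nhds hs'))).exp
  have hΓc : ContinuousOn Γ (Ici t₁) := fun s hs => (hΓd s hs).continuousAt.continuousWithinAt
  have hΓ1 : ContDiffOn ℝ 1 Γ (Ici t₁) :=
    contDiffOn_one_Ici (fun s hs => (hΓd s hs).hasDerivWithinAt)
      (hΓc.mul (hμ.mono (Ici_subset_Ici.2 ht₁.le)))
  have hW := (absolutelyContinuousOnInterval_of_contDiffOn hΓ1 le_rfl ht).fun_mul hE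
  have h1 := sub_le_integral_of_deriv_le (r := fun s => K / 2 * (Γ s * g s)) ht hW
    (((hΓc.mul hg).const_smul (K / 2)).mono Icc_subset_Ici_self) (by
      filter_upwards [h] with s hs hst _
      obtain ⟨hd, hle⟩ := hs hst
      rw [((hΓd s hst.le).fun_mul hd.hasDerivAt).deriv]
      have := mul_le_mul_of_nonneg_left hle (hΓpos s).le
      linarith)
  rw [intervalIntegral.integral_const_mul] at h1
  change E t ≤ K / (2 * Γ t) * (∫ s in t₁..t, Γ s * g s) + Γ t₁ * E t₁ / Γ t
  have hpos := hΓpos t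
  have h2 : K / (2 * Γ t) * (∫ s in t₁..t, Γ s * g s) + Γ t₁ * E t₁ / Γ t =
      (K / 2 * (∫ s in t₁..t, Γ s * g s) + Γ t₁ * E t₁) / Γ t := by field_simp
  rw [h2, le_div_iff₀ hpos]
  linarith

section Trajectory

variable {H : Type*} [NormedAddCommGroup H] [InnerProductSpace ℝ H]
  {Φ : H → EReal} {α β γ a c t₀ t : ℝ} {lam eps : ℝ → ℝ} {x : ℝ → H}

namespace IsAdmissible

lemma continuousOn_mu (h : IsAdmissible Φ t₀ lam eps) : ContinuousOn (mu α γ t₀ eps) (Ici t₀) :=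
  (continuousOn_const.mul h.contDiffOn_sqrt.continuousOn).sub
    (h.continuousOn_dt_eps.div (continuousOn_const.mul h.eps_contDiffOn.continuousOn)
      fun t ht => (mul_pos two_pos (h.eps_pos t ht)).ne')

lemma mu_nonneg (h : IsAdmissible Φ t₀ lam eps) (hγα : γ < α) (ht : t₀ ≤ t) :
    0 ≤ mu α γ t₀ eps t :=
  sub_nonneg.2 ((div_nonpos_of_nonpos_of_nonneg h.dt_eps_nonpos
    (mul_pos two_pos (h.eps_pos t ht)).le).trans
      (mul_nonneg (sub_nonneg.2 hγα.le) (Real.sqrt_nonneg _)))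

lemma continuousOn_gfun (h : IsAdmissible Φ t₀ lam eps) :
    ContinuousOn (gfun β γ a c t₀ lam eps) (Ici t₀) := by
  have hdl := h.continuousOn_dt_lam
  have hde := h.continuousOn_dt_eps
  have hl := h.lam_contDiffOn.continuousOn
  have he := h.eps_contDiffOn.continuousOn
  have hs := h.contDiffOn_sqrt.continuousOn
  have hq := ((continuousOn_const (c := (2 : ℝ))).mul hdl).div hl fun t ht => (h.lam_pos t ht).ne'
  have hq' := hde.div he fun t ht => (h.eps_pos t ht).ne'
  exact (((hdl.mul (he.pow 2)).sub hde).add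
    (((continuousOn_const.mul hde).mul hs).div_const 2)).add
    ((continuousOn_const.mul hs).mul ((hq.sub hq').pow 2))

lemma gfun_nonneg (h : IsAdmissible Φ t₀ lam eps) (hγ : 0 < γ) (ha : 0 < a) (hc : 0 < c)
    (hs : γ * β * √(eps t) ≤ 2) : 0 ≤ gfun β γ a c t₀ lam eps t := by
  have hdl : 0 ≤ dt t₀ lam t := h.dt_lam_nonneg
  have h1 : 0 ≤ -dt t₀ eps t * (1 - γ * β * √(eps t) / 2) :=
    mul_nonneg (neg_nonneg.2 h.dt_eps_nonpos) (by linarith)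
  have h2 : 0 ≤ γ * (2 * a + c * γ) * √(eps t)
      * (2 * dt t₀ lam t / lam t - dt t₀ eps t / eps t) ^ 2 := by positivity
  have h3 : 0 ≤ dt t₀ lam t * eps t ^ 2 := by positivity
  rw [gfun]
  linarith

lemma continuousOn_gradient_phi [CompleteSpace H] (h : IsAdmissible Φ t₀ lam eps)
    (hx : IsSolution Φ α β t₀ lam eps x) :
    ContinuousOn (fun t => gradient (phi Φ (eps t) (lam t)) (x t)) (Ici t₀) := by
  have hxc := hx.contDiffOn.continuousOn
  exact ((continuousOn_yosida h.potential h.nonempty (fun t ht => h.lam_pos t ht)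
    h.lam_contDiffOn.continuousOn hxc).add (h.eps_contDiffOn.continuousOn.smul hxc)).congr
    fun t ht => gradient_phi h.potential h.nonempty (h.lam_pos t ht) _ _

end IsAdmissible

end Trajectory

end Integration

end TikhonovMoreau

end

/-! ### The main theorem -/

theorem mainTheorem1 {H : Type*} [NormedAddCommGroup H] [InnerProductSpace ℝ H] [CompleteSpace H]
    (Φ : H → EReal) (hΦ : TikhonovMoreau.IsProperConvexLsc Φ)
    (hargmin : (TikhonovMoreau.argminSet Φ).Nonempty)
    (α β γ a c t₀ : ℝ) (hα : 0 < α) (hβ : 0 < β) (ht₀ : 0 < t₀)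
    (hγ : α / 2 ≤ γ) (hγα : γ < α) (ha : 0 < a) (hc : 0 < c)
    (lam eps : ℝ → ℝ)
    (hlam_pos : ∀ t, t₀ ≤ t → 0 < lam t) (hlam_C1 : ContDiffOn ℝ 1 lam (Ici t₀))
    (hlam_mono : MonotoneOn lam (Ici t₀))
    (heps_pos : ∀ t, t₀ ≤ t → 0 < eps t) (heps_C1 : ContDiffOn ℝ 1 eps (Ici t₀))
    (heps_anti : AntitoneOn eps (Ici t₀)) (heps_lim : Tendsto eps atTop (𝓝 0))
    (hlam_eps : Tendsto (fun t => lam t * eps t) atTop (𝓝 0))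
    (h0 : ∀ᶠ t in atTop, TikhonovMoreau.dt t₀ (fun s => 1 / √(eps s)) t ≤
      min (2 * γ - α - γ * β * TikhonovMoreau.dt t₀ eps t / (2 * eps t))
        (α - γ * ((a + 1) / a)))
    (h1 : ∀ᶠ t in atTop,
      (2 * γ * (α - γ) + γ / c - 1) * eps t - β * TikhonovMoreau.dt t₀ eps t ≤ 0)
    (h2 : ∀ᶠ t in atTop,
      2 * β * eps t ^ 2 + (2 - γ * β * √(eps t)) * TikhonovMoreau.dt t₀ eps t ≤ 0)
    (h3 : ∀ᶠ t in atTop,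
      (γ / a + 2 * (α - γ)) * β ^ 2 * √(eps t)
        - 3 * β ^ 2 * TikhonovMoreau.dt t₀ eps t / (2 * eps t)
        - TikhonovMoreau.dt t₀ lam t ≤ β)
    (x : ℝ → H) (hx : TikhonovMoreau.IsSolution Φ α β t₀ lam eps x) :
    let E : ℝ → ℝ := TikhonovMoreau.energy Φ β γ t₀ lam eps x
    let μ : ℝ → ℝ := TikhonovMoreau.mu α γ t₀ eps
    let g : ℝ → ℝ := TikhonovMoreau.gfun β γ a c t₀ lam eps
    let G : ℝ → H := fun t => gradient (TikhonovMoreau.phi Φ (eps t) (lam t)) (x t)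
    let xs : H := TikhonovMoreau.minNormSol Φ
    ∃ t₁, t₀ ≤ t₁ ∧
      (∀ T, t₁ ≤ T → AbsolutelyContinuousOnInterval E t₁ T) ∧
      (∀ᵐ t, t₁ < t → DifferentiableAt ℝ E t ∧
        deriv E t + μ t * E t + β / 2 * ‖G t‖ ^ 2 ≤ g t * ‖xs‖ ^ 2 / 2) ∧
      ∀ t, t₁ ≤ t →
        IntervalIntegrable (fun s => ‖G s‖ ^ 2) volume t₁ t ∧
        β * ∫ s in t₁..t, ‖G s‖ ^ 2 ≤ 2 * E t₁ + ‖xs‖ ^ 2 * ∫ s in t₁..t, g s ∧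
        E t ≤ ‖xs‖ ^ 2 / (2 * TikhonovMoreau.Gam α γ t₀ eps t₁ t)
              * (∫ s in t₁..t, TikhonovMoreau.Gam α γ t₀ eps t₁ s * g s)
            + TikhonovMoreau.Gam α γ t₀ eps t₁ t₁ * E t₁
              / TikhonovMoreau.Gam α γ t₀ eps t₁ t := by
  intro E μ g G xs
  have h : TikhonovMoreau.IsAdmissible Φ t₀ lam eps :=
    ⟨hΦ, hargmin, hlam_pos, hlam_C1, hlam_mono, heps_pos, heps_C1, heps_anti⟩
  have hγ0 : 0 < γ := (half_pos hα).trans_le hγ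
  have hsqrt : Tendsto (fun t => √(eps t)) atTop (𝓝 0) := by simpa using heps_lim.sqrt
  have hsm1 : ∀ᶠ t in atTop, √(eps t) * (β ^ 2 * (α - γ) + β ^ 2 * (α - γ - γ / a)
      + γ * β ^ 2 / a + 3 * a / (2 * γ) * (β * (α - γ - γ / a)) ^ 2) ≤ β / 2 := by
    refine (hsqrt.mul_const _).eventually (ge_mem_nhds ?_)
    rw [zero_mul]
    exact half_pos hβ
  have hsm2 : ∀ᶠ t in atTop, γ * β * √(eps t) ≤ 2 := by
    refine (hsqrt.const_mul _).eventually (ge_mem_nhds ?_)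
    rw [mul_zero]
    exact two_pos
  obtain ⟨t₁, ht₁⟩ := eventually_atTop.1
    ((eventually_gt_atTop t₀).and (h0.and (h1.and (h2.and (hsm1.and hsm2)))))
  have ht₀₁ : t₀ < t₁ := (ht₁ t₁ le_rfl).1
  have hAC : ∀ T, t₁ ≤ T → AbsolutelyContinuousOnInterval E t₁ T := fun T hT =>
    h.absolutelyContinuousOnInterval_energy hx ht₀₁.le hT
  have hdiff : ∀ᵐ t, t₁ < t → DifferentiableAt ℝ E t := by
    -- Absolute continuity is available on compact intervals only, so the half-line is exhausted by
    -- countably many of them.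
    have hn : ∀ᵐ t, ∀ n : ℕ, t ∈ uIcc t₁ (t₁ + n) → DifferentiableAt ℝ E t :=
      ae_all_iff.2 fun n => (hAC _ (le_add_of_nonneg_right n.cast_nonneg)).ae_differentiableAt
    filter_upwards [hn] with t ht htt
    obtain ⟨n, hn⟩ := exists_nat_ge (t - t₁)
    refine ht n ?_
    rw [uIcc_of_le (le_add_of_nonneg_right n.cast_nonneg)]
    exact ⟨htt.le, by linarith⟩
  have hmain : ∀ᵐ t, t₁ < t → DifferentiableAt ℝ E t ∧
      deriv E t + μ t * E t + β / 2 * ‖G t‖ ^ 2 ≤ g t * ‖xs‖ ^ 2 / 2 := by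
    filter_upwards [hdiff, hx.equation] with t hd heq ht
    obtain ⟨ht0, hh0, hh1, hh2, hh3, hh4⟩ := ht₁ t ht.le
    refine ⟨hd ht, (h.deriv_energy_le hx hβ hγ0 hγα ha hc ht0 hh0 hh1 hh2 hh3 (heq ht0)
      (hd ht)).trans ?_⟩
    -- Replacing ‖y‖ by the larger ‖x*‖ requires g ≥ 0, which holds once γβ√ε ≤ 2.
    have hg0 := h.gfun_nonneg hγ0 ha hc hh4
    have hle := TikhonovMoreau.norm_regMin_le hΦ hargmin (heps_pos t ht0.le) (hlam_pos t ht0.le)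
      (TikhonovMoreau.minNormSol_mem hΦ hargmin)
    gcongr
  have hsub : Ici t₁ ⊆ Ici t₀ := Ici_subset_Ici.2 ht₀₁.le
  have hGc : ContinuousOn (fun s => ‖G s‖ ^ 2) (Ici t₁) :=
    ((h.continuousOn_gradient_phi hx).norm.pow 2).mono hsub
  have hgc : ContinuousOn g (Ici t₁) := h.continuousOn_gfun.mono hsub
  refine ⟨t₁, ht₀₁.le, hAC, hmain, fun t ht => ⟨?_, ?_, ?_⟩⟩
  · refine (hGc.mono ?_).intervalIntegrable
    rw [uIcc_of_le ht]
    exact Icc_subset_Ici_self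
  · exact TikhonovMoreau.mul_integral_le_of_deriv_le ht (hAC t ht)
      (fun s hs => h.energy_nonneg (hsub hs)) (fun s hs => h.mu_nonneg hγα (hsub hs)) hgc hGc
      (hmain.mono fun s hs hst => (hs hst).2)
  · refine TikhonovMoreau.le_of_deriv_add_mul_le ht₀₁ ht (hAC t ht) h.continuousOn_mu hgc ?_
    filter_upwards [hmain] with s hs hst
    have : 0 ≤ β / 2 * ‖G s‖ ^ 2 := by positivity
    exact ⟨(hs hst).1, by linarith [(hs hst).2]⟩
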